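/- Throughout, theories are theories $U$ in classical first-order logic with identity over a finite signature, with an RE set of axioms; $\vdash$ is derivability, sentences are identified with their Gödel numbers, and $U$ is consistent if $U\nvdash\bot$. Pure $\Delta_0$-formulas are generated from $\bot$, $\top$, $u<v$, $0=u$, $\mathsf{S}u=v$, $u+v=w$, $u\times v=w$ ($u,v,w$ variables) by the propositional connectives $\neg,\wedge,\vee,\to$ and the bounded quantifiers $\forall u<v$, $\exists u<v$, $\forall u\le v$, $\exists u\le v$. A pure $1$-$\Sigma^0_1$-sentence is a sentence $\exists x\,\delta(x)$ where $\delta$ is pure $\Delta_0$ with at most $x$ free. It is true if it holds in $\mathbb N$. For $\sigma=\exists x\,\sigma_0(x)$ and $\tau=\exists y\,\tau_0(y)$, let $(\sigma<\tau)$ be the sentence $\exists x\,(\sigma_0(x)\wedge\forall y\le x\,\neg\tau_0(y))$ and let $(\sigma\le\tau)$ be the sentence $\exists x\,(\sigma_0(x)\wedge\forall y<x\,\neg\tau_0(y))$; these are again pure $1$-$\Sigma^0_1$-sentences. A consistent RE theory $U$ is $\Sigma^0_1$-representative if there is a recursive function $\Phi$ from pure $1$-$\Sigma^0_1$-sentences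 to $U$-sentences such that, for all pure $1$-$\Sigma^0_1$-sentences $\sigma,\tau$: (a) if $\sigma$ is true, then $U\vdash\Phi(\sigma)$; (b) if $\sigma\le\tau$ is true, then $U\vdash\neg\Phi(\tau<\sigma)$, and if $\sigma<\tau$ is true, then $U\vdash\neg\Phi(\tau\le\sigma)$. Let $U_{\mathfrak p}$ be the set of theorems of $U$, $U_{\mathfrak r}$ the set of sentences $\varphi$ with $U\vdash\neg\varphi$, and $W_i$ the RE set (of $U$-sentences) with index $i$. $U$ is effectively inseparable if there is a partial recursive function $\Phi$ such that, whenever $U_{\mathfrak p}\subseteq W_i$, $U_{\mathfrak r}\subseteq W_j$ and $W_i\cap W_j=\emptyset$, the value $\Phi(i,j)$ is defined, is a $U$-sentence, and $\Phi(i,j)\notin W_i\cup W_j$. **Theorem.** Let $U$ be a consistent RE theory. Then $U$ is $\Sigma^0_1$-representative if and only if $U$ is effectively inseparable. -/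

import Mathlib

open FirstOrder FirstOrder.Language

namespace SigmaRep

universe u v w

/-! ## Pure `Δ₀`-formulas and pure 1-`Σ⁰₁`-sentences -/

/-- Pure `Δ₀`-formulas of the language `0, S, +, ×, <` of arithmetic. Variables are de Bruijn
indices. In a bounded quantifier the number `v` is the bounding variable, which is read outside the
scope of the quantifier; inside its scope index `0` is the quantified variable and index `i + 1` is
the variable that has index `i` outside. -/
inductive PureDelta : Type
  | bot : PureDelta
  | top : PureDelta
  /-- `u < v` -/
  | lt (u v : ℕ) : PureDelta
  /-- `0 = u` -/
  | zero (u : ℕ) : PureDelta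
  /-- `S u = v` -/
  | succ (u v : ℕ) : PureDelta
  /-- `u + v = w` -/
  | add (u v w : ℕ) : PureDelta
  /-- `u × v = w` -/
  | mul (u v w : ℕ) : PureDelta
  | neg (δ : PureDelta) : PureDelta
  | and (δ ε : PureDelta) : PureDelta
  | or (δ ε : PureDelta) : PureDelta
  | imp (δ ε : PureDelta) : PureDelta
  /-- `∀ u < v, δ` -/
  | allLT (v : ℕ) (δ : PureDelta) : PureDelta
  /-- `∃ u < v, δ` -/
  | exLT (v : ℕ) (δ : PureDelta) : PureDelta
  /-- `∀ u ≤ v, δ` -/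
  | allLE (v : ℕ) (δ : PureDelta) : PureDelta
  /-- `∃ u ≤ v, δ` -/
  | exLE (v : ℕ) (δ : PureDelta) : PureDelta

/-- The assignment that gives index `0` the value `a` and index `i + 1` the value `e i`. -/
def push (a : ℕ) (e : ℕ → ℕ) : ℕ → ℕ
  | 0 => a
  | i + 1 => e i

namespace PureDelta

/-- All free variables have an index below `n`. -/
def Scoped : ℕ → PureDelta → Prop
  | _, bot => True
  | _, top => True
  | n, lt u v => u < n ∧ v < n
  | n, zero u => u < n
  | n, succ u v => u < n ∧ v < n
  | n, add u v w => u < n ∧ v < n ∧ w < n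
  | n, mul u v w => u < n ∧ v < n ∧ w < n
  | n, neg δ => δ.Scoped n
  | n, and δ ε => δ.Scoped n ∧ ε.Scoped n
  | n, or δ ε => δ.Scoped n ∧ ε.Scoped n
  | n, imp δ ε => δ.Scoped n ∧ ε.Scoped n
  | n, allLT v δ => v < n ∧ δ.Scoped (n + 1)
  | n, exLT v δ => v < n ∧ δ.Scoped (n + 1)
  | n, allLE v δ => v < n ∧ δ.Scoped (n + 1)
  | n, exLE v δ => v < n ∧ δ.Scoped (n + 1)

theorem Scoped.mono {δ : PureDelta} : ∀ {m n : ℕ}, δ.Scoped m → m ≤ n → δ.Scoped n := by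
  induction δ with
  | bot => intros; trivial
  | top => intros; trivial
  | lt u v => intro m n h hmn; exact ⟨h.1.trans_le hmn, h.2.trans_le hmn⟩
  | zero u => intro m n h hmn; exact lt_of_lt_of_le h hmn
  | succ u v => intro m n h hmn; exact ⟨h.1.trans_le hmn, h.2.trans_le hmn⟩
  | add u v w =>
    intro m n h hmn; exact ⟨h.1.trans_le hmn, h.2.1.trans_le hmn, h.2.2.trans_le hmn⟩
  | mul u v w =>
    intro m n h hmn; exact ⟨h.1.trans_le hmn, h.2.1.trans_le hmn, h.2.2.trans_le hmn⟩
  | neg δ ih => intro m n h hmn; exact ih (m := m) (n := n) h hmn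
  | and δ ε ih₁ ih₂ => intro m n h hmn; exact ⟨ih₁ h.1 hmn, ih₂ h.2 hmn⟩
  | or δ ε ih₁ ih₂ => intro m n h hmn; exact ⟨ih₁ h.1 hmn, ih₂ h.2 hmn⟩
  | imp δ ε ih₁ ih₂ => intro m n h hmn; exact ⟨ih₁ h.1 hmn, ih₂ h.2 hmn⟩
  | allLT v δ ih => intro m n h hmn; exact ⟨h.1.trans_le hmn, ih h.2 (Nat.succ_le_succ hmn)⟩
  | exLT v δ ih => intro m n h hmn; exact ⟨h.1.trans_le hmn, ih h.2 (Nat.succ_le_succ hmn)⟩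
  | allLE v δ ih => intro m n h hmn; exact ⟨h.1.trans_le hmn, ih h.2 (Nat.succ_le_succ hmn)⟩
  | exLE v δ ih => intro m n h hmn; exact ⟨h.1.trans_le hmn, ih h.2 (Nat.succ_le_succ hmn)⟩

/-- Satisfaction in the standard model `ℕ`. -/
def Holds : (ℕ → ℕ) → PureDelta → Prop
  | _, bot => False
  | _, top => True
  | e, lt u v => e u < e v
  | e, zero u => 0 = e u
  | e, succ u v => e u + 1 = e v
  | e, add u v w => e u + e v = e w
  | e, mul u v w => e u * e v = e w
  | e, neg δ => ¬ δ.Holds e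
  | e, and δ ε => δ.Holds e ∧ ε.Holds e
  | e, or δ ε => δ.Holds e ∨ ε.Holds e
  | e, imp δ ε => δ.Holds e → ε.Holds e
  | e, allLT v δ => ∀ a, a < e v → δ.Holds (push a e)
  | e, exLT v δ => ∃ a, a < e v ∧ δ.Holds (push a e)
  | e, allLE v δ => ∀ a, a ≤ e v → δ.Holds (push a e)
  | e, exLE v δ => ∃ a, a ≤ e v ∧ δ.Holds (push a e)

/-- The Gödel number of a pure `Δ₀`-formula. -/
def code : PureDelta → ℕ
  | bot => Nat.pair 0 0
  | top => Nat.pair 1 0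
  | lt u v => Nat.pair 2 (Nat.pair u v)
  | zero u => Nat.pair 3 u
  | succ u v => Nat.pair 4 (Nat.pair u v)
  | add u v w => Nat.pair 5 (Nat.pair u (Nat.pair v w))
  | mul u v w => Nat.pair 6 (Nat.pair u (Nat.pair v w))
  | neg δ => Nat.pair 7 δ.code
  | and δ ε => Nat.pair 8 (Nat.pair δ.code ε.code)
  | or δ ε => Nat.pair 9 (Nat.pair δ.code ε.code)
  | imp δ ε => Nat.pair 10 (Nat.pair δ.code ε.code)
  | allLT v δ => Nat.pair 11 (Nat.pair v δ.code)
  | exLT v δ => Nat.pair 12 (Nat.pair v δ.code)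
  | allLE v δ => Nat.pair 13 (Nat.pair v δ.code)
  | exLE v δ => Nat.pair 14 (Nat.pair v δ.code)

end PureDelta

/-- A pure 1-`Σ⁰₁`-sentence `∃ x, δ(x)`: one unbounded existential quantifier in front of a pure
`Δ₀`-formula `δ` in which at most `x` (index `0`) is free. -/
structure PureSigma : Type where
  matrix : PureDelta
  closed : matrix.Scoped 1

namespace PureSigma

/-- Truth in the standard model. As only index `0` is free in the matrix, the value `0` that the
other indices receive plays no role. -/
def IsTrue (σ : PureSigma) : Prop := ∃ a : ℕ, σ.matrix.Holds (push a fun _ => 0)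

/-- The sentence `σ < τ`, which is `∃ x, (σ₀(x) ∧ ∀ y ≤ x, ¬ τ₀(y))`. -/
def wlt (σ τ : PureSigma) : PureSigma where
  matrix := .and σ.matrix (.allLE 0 (.neg τ.matrix))
  closed := ⟨σ.closed, Nat.one_pos, τ.closed.mono (Nat.le_succ 1)⟩

/-- The sentence `σ ≤ τ`, which is `∃ x, (σ₀(x) ∧ ∀ y < x, ¬ τ₀(y))`. -/
def wle (σ τ : PureSigma) : PureSigma where
  matrix := .and σ.matrix (.allLT 0 (.neg τ.matrix))
  closed := ⟨σ.closed, Nat.one_pos, τ.closed.mono (Nat.le_succ 1)⟩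

/-- The Gödel number of `∃ x, δ(x)` is that of `δ`. -/
def code (σ : PureSigma) : ℕ := σ.matrix.code

end PureSigma

/-! ## Derivability in classical predicate logic with identity -/

section Logic

variable {L : FirstOrder.Language.{u, v}}

/-- The term map that replaces the bound variable `0` by the term `t` and renumbers the other
bound variables. -/
def instVar (t : L.Term ℕ) {k : ℕ} : ℕ ⊕ Fin (k + 1) → L.Term (ℕ ⊕ Fin k) :=
  Sum.elim (fun a => Term.var (Sum.inl a))
    (Fin.cases (t.relabel Sum.inl) fun i => Term.var (Sum.inr i))

/-- Substitution of the term `t` for the variable `0` of `Fin (k + 1)`. For `k = 0` this takes the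
body `φ(x)` of a quantified formula `∀ x, φ(x)` to `φ(t)`. -/
def instantiate (t : L.Term ℕ) : {k : ℕ} → L.BoundedFormula ℕ (k + 1) → L.BoundedFormula ℕ k
  | _, .falsum => .falsum
  | _, .equal s₁ s₂ => .equal (s₁.subst (instVar t)) (s₂.subst (instVar t))
  | _, .rel R ts => .rel R fun i => (ts i).subst (instVar t)
  | _, .imp φ ψ => .imp (instantiate t φ) (instantiate t ψ)
  | _, .all φ => .all (instantiate t φ)

/-- A sentence as a formula over the free variables `ℕ`. -/
def ofSentence (σ : L.Sentence) : L.Formula ℕ :=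
  BoundedFormula.subst σ fun a : Empty => a.elim

/-- Hilbert-style derivability from the axioms `T` in classical first-order logic with identity,
for formulas whose free variables are indexed by `ℕ`. -/
inductive Derivable (T : L.Theory) : L.Formula ℕ → Prop
  | hyp {σ : L.Sentence} : σ ∈ T → Derivable T (ofSentence σ)
  | axK (φ ψ : L.Formula ℕ) : Derivable T (φ.imp (ψ.imp φ))
  | axS (φ ψ χ : L.Formula ℕ) :
      Derivable T ((φ.imp (ψ.imp χ)).imp ((φ.imp ψ).imp (φ.imp χ)))
  | axDN (φ : L.Formula ℕ) :
      Derivable T (((φ.imp BoundedFormula.falsum).imp BoundedFormula.falsum).imp φ)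
  | mp {φ ψ : L.Formula ℕ} : Derivable T (φ.imp ψ) → Derivable T φ → Derivable T ψ
  | axInst (φ : L.BoundedFormula ℕ 1) (t : L.Term ℕ) : Derivable T (φ.all.imp (instantiate t φ))
  | gen {ψ : L.Formula ℕ} {φ : L.BoundedFormula ℕ 1} {x : ℕ} :
      x ∉ ψ.freeVarFinset → x ∉ φ.freeVarFinset →
      Derivable T (ψ.imp (instantiate (Term.var x) φ)) → Derivable T (ψ.imp φ.all)
  | axRefl (t : L.Term ℕ) : Derivable T (t.equal t)
  | axLeibniz (s t : L.Term ℕ) (φ : L.BoundedFormula ℕ 1) :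
      Derivable T ((s.equal t).imp ((instantiate s φ).imp (instantiate t φ)))

/-- `T ⊢ σ` for a sentence `σ`. -/
def Proves (T : L.Theory) (σ : L.Sentence) : Prop := Derivable T (ofSentence σ)

def Consistent (T : L.Theory) : Prop := ¬ Proves T ⊥

/-- The set of theorems of `T`. -/
def provable (T : L.Theory) : Set L.Sentence := {φ | Proves T φ}

/-- The set of sentences that `T` refutes. -/
def refutable (T : L.Theory) : Set L.Sentence := {φ | Proves T φ.not}

end Logic

/-! ## Gödel numbers and recursion-theoretic notions -/

section Coding

variable {L : FirstOrder.Language.{u, v}}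
  [Encodable (Σ n, L.Functions n)] [Encodable (Σ n, L.Relations n)]

/-- The Gödel number of a term, from numberings of the variables and the function symbols. -/
def termCode {β : Type w} [Encodable β] : L.Term β → ℕ
  | .var b => Nat.pair 0 (Encodable.encode b)
  | @Term.func _ _ n f ts =>
      Nat.pair 1 (Nat.pair (Encodable.encode (⟨n, f⟩ : Σ n, L.Functions n))
        (Encodable.encode (List.ofFn fun i => termCode (ts i))))

/-- The Gödel number of a formula. -/
def formulaCode {α : Type w} [Encodable α] : {n : ℕ} → L.BoundedFormula α n → ℕ
  | _, .falsum => Nat.pair 0 0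
  | _, .equal s t => Nat.pair 1 (Nat.pair (termCode s) (termCode t))
  | _, @BoundedFormula.rel _ _ _ l R ts =>
      Nat.pair 2 (Nat.pair (Encodable.encode (⟨l, R⟩ : Σ n, L.Relations n))
        (Encodable.encode (List.ofFn fun i => termCode (ts i))))
  | _, .imp φ ψ => Nat.pair 3 (Nat.pair (formulaCode φ) (formulaCode ψ))
  | _, .all φ => Nat.pair 4 (formulaCode φ)

/-- The Gödel number of a sentence. -/
def sentenceCode (φ : L.Sentence) : ℕ := formulaCode φ

/-- `T` is an RE set of axioms. -/
def IsRE (T : L.Theory) : Prop := REPred fun n : ℕ => ∃ φ ∈ T, sentenceCode φ = n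

/-- The set of sentences whose Gödel numbers lie in the RE set with index `c`, that is, in the
domain of the partial recursive function with index `c`. -/
def W (c : Nat.Partrec.Code) : Set L.Sentence := {φ | (c.eval (sentenceCode φ)).Dom}

/-- The sets of sentences provable and refutable in `T` are effectively inseparable. -/
def EffectivelyInseparable (T : L.Theory) : Prop :=
  ∃ Φ : Nat.Partrec.Code × Nat.Partrec.Code →. ℕ, Partrec Φ ∧
    ∀ i j : Nat.Partrec.Code, provable T ⊆ W i → refutable T ⊆ W j →
      Disjoint (W i : Set L.Sentence) (W j) →
      ∃ φ : L.Sentence, sentenceCode φ ∈ Φ (i, j) ∧ φ ∉ W i ∧ φ ∉ W j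

/-- The map `Φ` from pure 1-`Σ⁰₁`-sentences to `L`-sentences is recursive. -/
def IsRecursive (Φ : PureSigma → L.Sentence) : Prop :=
  ∃ f : ℕ → ℕ, Computable f ∧ ∀ σ : PureSigma, f σ.code = sentenceCode (Φ σ)

def SigmaRepresentative (T : L.Theory) : Prop :=
  ∃ Φ : PureSigma → L.Sentence, IsRecursive Φ ∧
    (∀ σ : PureSigma, σ.IsTrue → Proves T (Φ σ)) ∧
    ∀ σ τ : PureSigma,
      ((σ.wle τ).IsTrue → Proves T (Φ (τ.wlt σ)).not) ∧
      ((σ.wlt τ).IsTrue → Proves T (Φ (τ.wle σ)).not)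

end Coding

end SigmaRep

/-!
Both directions rest on fixed points for partial recursive functions and on two facts of
arithmetization.

If `U` is `Σ⁰₁`-representative through `Φ`, then for given `i` and `j` a fixed point yields
`Σ⁰₁`-sentences `σ` and `τ` such that, for `φ = Φ(σ ≤ τ)`, `σ` is true if and only if `φ ∈ W j`, and
`τ` is true if and only if `φ ∈ W i`. If `φ ∈ W j`, then `φ ∉ W i`, so `σ ≤ τ` is true, `U` proves
`φ`, and `φ ∈ W i`, a contradiction. If `φ ∈ W i`, then `τ < σ` is true, `U` refutes `φ`, and
`φ ∈ W j`, again a contradiction. This is `SigmaRepresentative.effectivelyInseparable`. It needs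
recursive enumerability to be expressible by true pure 1-`Σ⁰₁`-sentences
(`exists_pureSigma_of_rePred`), which follows from an induction on the partial recursive functions
with Gödel's `β`-function for primitive recursion.

Conversely, if `U` is effectively inseparable, then every disjoint pair of RE sets is separated by
the pair of provable and refutable sentences through a total recursive function
(`EffectivelyInseparable.exists_reduction`). The pair to which this is applied consists of the true
sentences and of the sentences `τ < σ` with `σ ≤ τ` true or `τ ≤ σ` with `σ < τ` true; it is
disjoint because `σ ≤ τ` and `τ < σ` exclude each other. This direction needs the theorems of `U` and
the true `Σ⁰₁`-sentences to be recursively enumerable (`exists_rePred_iff_proves`, `rePred_isTrue`).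
Both sets are sections of Horn closures, that is, of least sets of coded statements closed under an
RE set of rules, and such a closure is RE (`rePred_closure`).
-/

open FirstOrder FirstOrder.Language

namespace SigmaRep

universe u v w

/-! ### Computability by `fun_prop` -/

section FunProp

variable {α β γ δ : Type*} [Primcodable α] [Primcodable β] [Primcodable γ] [Primcodable δ]

attribute [fun_prop] Computable

@[fun_prop]
theorem computable_id : Computable fun a : α => a := Computable.id

@[fun_prop]
theorem computable_const (b : β) : Computable fun _ : α => b := Computable.const b

@[fun_prop]
theorem computable_comp {f : β → γ} {g : α → β} (hf : Computable f) (hg : Computable g) :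
    Computable fun a => f (g a) := hf.comp hg

@[fun_prop]
theorem computable_pair {f : α → β} {g : α → γ} (hf : Computable f) (hg : Computable g) :
    Computable fun a => (f a, g a) := hf.pair hg

@[fun_prop]
theorem computable_fst {f : α → β × γ} (hf : Computable f) : Computable fun a => (f a).1 :=
  Computable.fst.comp hf

@[fun_prop]
theorem computable_snd {f : α → β × γ} (hf : Computable f) : Computable fun a => (f a).2 :=
  Computable.snd.comp hf

@[fun_prop]
theorem computable_natPair {f g : α → ℕ} (hf : Computable f) (hg : Computable g) :
    Computable fun a => Nat.pair (f a) (g a) := Primrec₂.natPair.to_comp.comp hf hg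

@[fun_prop]
theorem computable_cons {f : α → β} {g : α → List β} (hf : Computable f) (hg : Computable g) :
    Computable fun a => f a :: g a := Computable.list_cons.comp hf hg

@[fun_prop]
theorem computable_add {f g : α → ℕ} (hf : Computable f) (hg : Computable g) :
    Computable fun a => f a + g a := Primrec.nat_add.to_comp.comp hf hg

@[fun_prop]
theorem computable_mul {f g : α → ℕ} (hf : Computable f) (hg : Computable g) :
    Computable fun a => f a * g a := Primrec.nat_mul.to_comp.comp hf hg

@[fun_prop]
theorem computable_sub {f g : α → ℕ} (hf : Computable f) (hg : Computable g) :
    Computable fun a => f a - g a := Primrec.nat_sub.to_comp.comp hf hg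

@[fun_prop]
theorem computable_getElem? {f : α → List β} {g : α → ℕ} (hf : Computable f)
    (hg : Computable g) : Computable fun a => (f a)[g a]? := Computable.list_getElem?.comp hf hg

@[fun_prop]
theorem computable_some {f : α → β} (hf : Computable f) : Computable fun a => some (f a) :=
  Computable.option_some.comp hf

end FunProp

/-! ### Closure properties of recursively enumerable predicates -/

section REPred

variable {α β : Type*} [Primcodable α] [Primcodable β]

theorem rePred_iff_exists_partrec {p : α → Prop} :
    REPred p ↔ ∃ f : α →. Unit, Partrec f ∧ ∀ a, p a ↔ (f a).Dom := by
  refine ⟨fun h => ⟨_, h, fun a => ?_⟩, fun ⟨f, hf, h⟩ => hf.dom_re.of_eq fun a => (h a).symm⟩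
  simp [Part.assert]

theorem _root_.REPred.preimage {p : β → Prop} (hp : REPred p) {f : α → β} (hf : Computable f) :
    REPred fun a => p (f a) := Partrec.comp hp hf

theorem _root_.REPred.or {p q : α → Prop} (hp : REPred p) (hq : REPred q) :
    REPred fun a => p a ∨ q a := by
  obtain ⟨f, hf, hpf⟩ := rePred_iff_exists_partrec.1 hp
  obtain ⟨g, hg, hqg⟩ := rePred_iff_exists_partrec.1 hq
  obtain ⟨k, hk, h⟩ := Partrec.merge' hf hg
  exact hk.dom_re.of_eq fun a => by rw [(h a).2, hpf, hqg]

theorem _root_.REPred.and {p q : α → Prop} (hp : REPred p) (hq : REPred q) :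
    REPred fun a => p a ∧ q a := by
  obtain ⟨f, hf, hpf⟩ := rePred_iff_exists_partrec.1 hp
  obtain ⟨g, hg, hqg⟩ := rePred_iff_exists_partrec.1 hq
  have hg' : Partrec₂ fun (a : α) (_ : Unit) => g a := hg.comp Computable.fst
  refine (hf.bind hg').dom_re.of_eq fun a => ?_
  rw [hpf, hqg, Part.bind_dom]
  exact exists_prop

theorem rePred_of_decide {p : α → Prop} [DecidablePred p] (h : Computable fun a => decide (p a)) :
    REPred p := ComputablePred.to_re ⟨inferInstance, h⟩

theorem rePred_eq [DecidableEq β] {f g : α → β} (hf : Computable f) (hg : Computable g) :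
    REPred fun a => f a = g a :=
  rePred_of_decide ((PrimrecRel.decide Primrec.eq).to_comp.comp hf hg)

theorem rePred_lt {f g : α → ℕ} (hf : Computable f) (hg : Computable g) :
    REPred fun a => f a < g a :=
  rePred_of_decide ((PrimrecRel.decide Primrec.nat_lt).to_comp.comp hf hg)

theorem rePred_false : REPred fun _ : α => False :=
  rePred_of_decide (by simpa using Computable.const false)

/-- Every recursively enumerable predicate has a recursive enumeration; the value `none` stands for
a stage of the enumeration at which nothing new is listed. -/
theorem _root_.REPred.exists_enum {p : α → Prop} (hp : REPred p) :
    ∃ r : ℕ → Option α, Computable r ∧ ∀ a, p a ↔ ∃ n, r n = some a := by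
  have hpart : Nat.Partrec fun n => Part.bind (Encodable.decode (α := α) n) fun a =>
      (Part.assert (p a) fun _ => Part.some ()).map Encodable.encode := hp
  obtain ⟨c, hc⟩ := Nat.Partrec.Code.exists_code.1 hpart
  have hev : Computable fun n : ℕ => Nat.Partrec.Code.evaln n.unpair.1 c n.unpair.2 :=
    Nat.Partrec.Code.primrec_evaln.to_comp.comp
      ((Computable.fst.comp Computable.unpair |>.pair (Computable.const c)).pair
        (Computable.snd.comp Computable.unpair))
  refine ⟨fun n => (Nat.Partrec.Code.evaln n.unpair.1 c n.unpair.2).bind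
    fun _ => Encodable.decode (α := α) n.unpair.2, ?_, fun a => ?_⟩
  · exact Computable.option_bind hev
      ((Computable.decode.comp (Computable.snd.comp Computable.unpair)).comp Computable.fst)
  · have key : ∀ m, (∃ x, x ∈ c.eval m) ↔ ∃ b : α, Encodable.decode m = some b ∧ p b := by
      intro m
      simp only [hc, Part.mem_bind_iff, Part.mem_map_iff, Part.mem_assert_iff, Part.mem_ofOption,
        Option.mem_def]
      exact ⟨fun ⟨_, b, hb, _, ⟨hp, _⟩, _⟩ => ⟨b, hb, hp⟩,
        fun ⟨b, hb, hp⟩ => ⟨_, b, hb, (), ⟨hp, Part.mem_some _⟩, rfl⟩⟩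
    constructor
    · intro h
      obtain ⟨x, hx⟩ := (key (Encodable.encode a)).2 ⟨a, by simp, h⟩
      obtain ⟨k, hk⟩ := Nat.Partrec.Code.evaln_complete.1 hx
      refine ⟨Nat.pair k (Encodable.encode a), ?_⟩
      simp only [Nat.unpair_pair, Encodable.encodek]
      rw [Option.mem_def.1 hk]
      rfl
    · rintro ⟨n, hn⟩
      obtain ⟨x, hx, ha⟩ := Option.bind_eq_some_iff.1 hn
      obtain ⟨b, hb, hpb⟩ := (key n.unpair.2).1 ⟨x, Nat.Partrec.Code.evaln_sound hx⟩
      rw [ha] at hb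
      rwa [Option.some.inj hb]

theorem rePred_of_enum {r : ℕ → Option α} (hr : Computable r) :
    REPred fun a => ∃ n, r n = some a := by
  classical
  have h : Computable₂ fun (a : α) (n : ℕ) =>
      bif decide ((r n).map Encodable.encode = some (Encodable.encode a)) then some () else none :=
    Computable.cond
      ((PrimrecRel.decide (Primrec.eq (α := Option ℕ))).to_comp.comp
        (Computable.option_map (hr.comp Computable.snd) (Computable.encode.comp Computable.snd))
        (Computable.option_some.comp (Computable.encode.comp Computable.fst)))
      (Computable.const _) (Computable.const _)
  refine (Partrec.rfindOpt h).dom_re.of_eq fun a => ?_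
  rw [Nat.rfindOpt_dom]
  refine exists_congr fun n => ?_
  have hinj : (r n).map Encodable.encode = some (Encodable.encode a) ↔ r n = some a := by
    rw [Option.map_eq_some_iff]
    constructor
    · rintro ⟨b, hb, hba⟩; rw [hb, Encodable.encode_injective hba]
    · intro h; exact ⟨a, h, rfl⟩
  by_cases hr' : r n = some a
  · simp [hr']
  · have := mt hinj.1 hr'
    simp only [this, decide_false, cond_false, hr', iff_false]
    simp

theorem _root_.REPred.exists {p : α → β → Prop} (hp : REPred fun x : α × β => p x.1 x.2) :
    REPred fun a => ∃ b, p a b := by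
  obtain ⟨r, hr, h⟩ := hp.exists_enum
  refine (rePred_of_enum (r := fun n => (r n).map Prod.fst)
    (Computable.option_map hr (Computable.fst.comp Computable.snd))).of_eq fun a => ?_
  constructor
  · rintro ⟨n, hn⟩
    obtain ⟨x, hx, rfl⟩ := Option.map_eq_some_iff.1 hn
    exact ⟨x.2, (h x).2 ⟨n, hx⟩⟩
  · rintro ⟨b, hb⟩
    obtain ⟨n, hn⟩ := (h (a, b)).1 hb
    exact ⟨n, by simp [hn]⟩

theorem _root_.Partrec.rePred_mem [DecidableEq β] {f : α →. β} (hf : Partrec f) :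
    REPred fun x : α × β => x.2 ∈ f x.1 := by
  have hq : REPred fun y : (α × β) × β => y.2 = y.1.2 :=
    rePred_eq (by fun_prop) (by fun_prop)
  have hb : Partrec fun x : α × β => (f x.1).bind fun b =>
      Part.assert (b = x.2) fun _ => Part.some () :=
    Partrec.bind (hf.comp Computable.fst) hq
  refine hb.dom_re.of_eq fun x => ?_
  rw [Part.dom_iff_mem]
  simp

theorem rePred_of_finite {p : α → Prop} (h : {a | p a}.Finite) : REPred p := by
  classical
  have : ∀ l : List α, REPred fun a => a ∈ l := by
    intro l
    induction l with
    | nil => simpa using rePred_false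
    | cons b l ih =>
      refine ((rePred_eq computable_id (computable_const b)).or ih).of_eq fun a => ?_
      simp
  exact (this h.toFinset.toList).of_eq fun a => by simp

end REPred

/-! ### Horn closures of recursively enumerable rule sets -/

section Closure

variable {α : Type*}

/-- The least set that is closed under the rules `ρ`, where `ρ ps c` is the rule with the list of
premises `ps` and the conclusion `c`. -/
inductive Closure (ρ : List α → α → Prop) : α → Prop
  | intro {ps : List α} {c : α} : ρ ps c → (∀ p ∈ ps, Closure ρ p) → Closure ρ c

/-- The conclusions reached after `k` stages, where stage `k` tries the rule that the enumeration
`r` lists at the first component of `k`; so each rule is tried infinitely often. -/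
def closureStage [DecidableEq α] (r : ℕ → Option (List α × α)) : ℕ → List α
  | 0 => []
  | k + 1 =>
    match r k.unpair.1 with
    | none => closureStage r k
    | some x => bif decide (∀ p ∈ x.1, p ∈ closureStage r k) then x.2 :: closureStage r k
        else closureStage r k

theorem closureStage_mono [DecidableEq α] (r : ℕ → Option (List α × α)) {k l : ℕ} (h : k ≤ l) :
    closureStage r k ⊆ closureStage r l := by
  induction h with
  | refl => exact List.Subset.refl _
  | @step k _ ih =>
  refine List.Subset.trans ih fun a ha => ?_
  rw [closureStage]
  split
  · exact ha
  · rename_i x _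
    cases h : decide (∀ p ∈ x.1, p ∈ closureStage r k)
    · exact ha
    · exact List.mem_cons_of_mem _ ha

variable [Primcodable α]

theorem primrecRel_mem_list [DecidableEq α] : PrimrecRel fun (a : α) (l : List α) => a ∈ l := by
  have h : PrimrecRel fun (l : List α) (a : α) => ∃ b ∈ l, b = a :=
    PrimrecRel.exists_mem_list Primrec.eq
  exact (h.swap).of_eq fun a l => by simp [Function.swap]

theorem computable_closureStage [DecidableEq α] {r : ℕ → Option (List α × α)}
    (hr : Computable r) : Computable (closureStage r) := by
  have hall : PrimrecRel fun (ps l : List α) => ∀ p ∈ ps, p ∈ l :=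
    PrimrecRel.forall_mem_list primrecRel_mem_list
  have hstep : Computable₂ fun (_ : ℕ) (y : ℕ × List α) =>
      Option.casesOn (motive := fun _ => List α) (r y.1.unpair.1) y.2 fun x =>
        bif decide (∀ p ∈ x.1, p ∈ y.2) then x.2 :: y.2 else y.2 := by
    refine Computable.option_casesOn (o := fun z : ℕ × (ℕ × List α) => r z.2.1.unpair.1)
      (hr.comp (Computable.fst.comp (Computable.unpair.comp (by fun_prop)))) (by fun_prop) ?_
    exact Computable.cond
      (hall.decide.to_comp.comp (g := fun w : (ℕ × (ℕ × List α)) × (List α × α) => w.2.1)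
        (h := fun w => w.1.2.2) (by fun_prop) (by fun_prop))
      (by fun_prop) (by fun_prop)
  refine (Computable.nat_rec computable_id (computable_const []) hstep).of_eq fun k => ?_
  induction k with
  | zero => rfl
  | succ k ih =>
    simp only [closureStage]
    simp only at ih
    rw [ih]
    cases r k.unpair.1 <;> rfl

/-- The least set closed under a recursively enumerable set of rules is recursively enumerable. -/
theorem rePred_closure {ρ : List α → α → Prop}
    (hρ : REPred fun x : List α × α => ρ x.1 x.2) : REPred (Closure ρ) := by
  classical
  let _ : DecidableEq α := Encodable.decidableEqOfEncodable α
  obtain ⟨r, hr, h⟩ := hρ.exists_enum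
  have hmem : REPred fun x : α × ℕ => x.1 ∈ closureStage r x.2 :=
    rePred_of_decide (primrecRel_mem_list.decide.to_comp.comp Computable.fst
      ((computable_closureStage hr).comp Computable.snd))
  refine (REPred.exists (p := fun a k => a ∈ closureStage r k) hmem).of_eq fun a => ?_
  constructor
  · rintro ⟨k, hk⟩
    induction k generalizing a with
    | zero => simp [closureStage] at hk
    | succ k ih =>
      rw [closureStage] at hk
      split at hk
      · exact ih a hk
      · rename_i x hx
        by_cases hd : ∀ p ∈ x.1, p ∈ closureStage r k
        · rw [decide_eq_true hd, cond_true, List.mem_cons] at hk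
          rcases hk with rfl | hk
          · exact .intro ((h x).2 ⟨_, hx⟩) fun p hp => ih p (hd p hp)
          · exact ih a hk
        · rw [decide_eq_false hd, cond_false] at hk
          exact ih a hk
  · intro ha
    induction ha with
    | @intro ps c hc hps ih =>
      have hbound : ∃ K, ∀ p ∈ ps, p ∈ closureStage r K := by
        clear hc hps
        induction ps with
        | nil => exact ⟨0, by simp⟩
        | cons q qs ihq =>
          obtain ⟨K, hK⟩ := ihq fun p hp => ih p (List.mem_cons_of_mem _ hp)
          obtain ⟨k, hk⟩ := ih q List.mem_cons_self
          refine ⟨max k K, fun p hp => ?_⟩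
          rcases List.mem_cons.1 hp with rfl | hp
          · exact closureStage_mono r (le_max_left _ _) hk
          · exact closureStage_mono r (le_max_right _ _) (hK p hp)
      obtain ⟨K, hK⟩ := hbound
      obtain ⟨n, hn⟩ := (h (ps, c)).1 hc
      refine ⟨Nat.pair n K + 1, ?_⟩
      have hd : ∀ p ∈ ps, p ∈ closureStage r (Nat.pair n K) := fun p hp =>
        closureStage_mono r (Nat.right_le_pair n K) (hK p hp)
      rw [closureStage, Nat.unpair_pair]
      simp only [hn]
      rw [decide_eq_true hd, cond_true]
      exact List.mem_cons_self

end Closure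

/-! ### Pure `Σ⁰₁`-definability -/

section Definability

namespace PureDelta

/-- The renaming of variables that acts by `r` outside a quantifier, seen from inside it. -/
def liftRenaming (r : ℕ → ℕ) : ℕ → ℕ
  | 0 => 0
  | i + 1 => r i + 1

/-- Renaming of the free variables of a pure `Δ₀`-formula. -/
def rename : (ℕ → ℕ) → PureDelta → PureDelta
  | _, bot => bot
  | _, top => top
  | r, lt u v => lt (r u) (r v)
  | r, zero u => zero (r u)
  | r, succ u v => succ (r u) (r v)
  | r, add u v w => add (r u) (r v) (r w)
  | r, mul u v w => mul (r u) (r v) (r w)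
  | r, neg δ => neg (δ.rename r)
  | r, and δ ε => and (δ.rename r) (ε.rename r)
  | r, or δ ε => or (δ.rename r) (ε.rename r)
  | r, imp δ ε => imp (δ.rename r) (ε.rename r)
  | r, allLT v δ => allLT (r v) (δ.rename (liftRenaming r))
  | r, exLT v δ => exLT (r v) (δ.rename (liftRenaming r))
  | r, allLE v δ => allLE (r v) (δ.rename (liftRenaming r))
  | r, exLE v δ => exLE (r v) (δ.rename (liftRenaming r))

theorem push_comp_liftRenaming (a : ℕ) (e r : ℕ → ℕ) :
    push a e ∘ liftRenaming r = push a (e ∘ r) := by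
  funext i; cases i <;> rfl

theorem holds_rename {δ : PureDelta} : ∀ {r e : ℕ → ℕ},
    (δ.rename r).Holds e ↔ δ.Holds (e ∘ r) := by
  induction δ <;> intro r e <;> simp_all [rename, Holds, push_comp_liftRenaming]

theorem liftRenaming_lt {r : ℕ → ℕ} {n : ℕ} (h : ∀ i, r i < n) (i : ℕ) :
    liftRenaming r i < n + 1 := by
  cases i with
  | zero => exact Nat.succ_pos n
  | succ i => exact Nat.succ_lt_succ (h i)

theorem scoped_rename {δ : PureDelta} : ∀ {r : ℕ → ℕ} {n : ℕ}, (∀ i, r i < n) →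
    (δ.rename r).Scoped n := by
  induction δ <;> intro r n h <;> simp_all [rename, Scoped]
  all_goals rename_i ih; exact ih (liftRenaming_lt h)

end PureDelta

open PureDelta

/-- The predicates of assignments that are defined by a pure `Δ₀`-formula behind one unbounded
existential quantifier. -/
def IsSigma (P : (ℕ → ℕ) → Prop) : Prop :=
  ∃ δ : PureDelta, ∀ e, P e ↔ ∃ x, δ.Holds (push x e)

/-- The assignment seen from outside the innermost quantifier. -/
def pop (e : ℕ → ℕ) : ℕ → ℕ := fun i => e (i + 1)

namespace IsSigma

variable {P Q : (ℕ → ℕ) → Prop}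

theorem of_eq (hP : IsSigma P) (h : ∀ e, P e ↔ Q e) : IsSigma Q := by
  obtain ⟨δ, hδ⟩ := hP
  exact ⟨δ, fun e => (h e).symm.trans (hδ e)⟩

theorem of_delta (δ : PureDelta) : IsSigma fun e => δ.Holds e :=
  ⟨δ.rename Nat.succ, fun e => by
    simp only [holds_rename]
    exact ⟨fun h => ⟨0, h⟩, fun ⟨_, h⟩ => h⟩⟩

theorem and (hP : IsSigma P) (hQ : IsSigma Q) : IsSigma fun e => P e ∧ Q e := by
  obtain ⟨δ, hδ⟩ := hP
  obtain ⟨ε, hε⟩ := hQ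
  -- the outer quantifier bounds both witnesses
  refine ⟨.and (.exLE 0 (δ.rename (liftRenaming Nat.succ)))
    (.exLE 0 (ε.rename (liftRenaming Nat.succ))), fun e => ?_⟩
  simp only [Holds, holds_rename, push_comp_liftRenaming, hδ, hε]
  constructor
  · rintro ⟨⟨x, hx⟩, ⟨y, hy⟩⟩
    exact ⟨max x y, ⟨x, le_max_left x y, hx⟩, ⟨y, le_max_right x y, hy⟩⟩
  · rintro ⟨_, ⟨x, _, hx⟩, ⟨y, _, hy⟩⟩
    exact ⟨⟨x, hx⟩, ⟨y, hy⟩⟩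

theorem or (hP : IsSigma P) (hQ : IsSigma Q) : IsSigma fun e => P e ∨ Q e := by
  obtain ⟨δ, hδ⟩ := hP
  obtain ⟨ε, hε⟩ := hQ
  refine ⟨.or δ ε, fun e => ?_⟩
  simp only [Holds, hδ, hε, exists_or]

/-- Existential quantification: in the premise the quantified variable has index `0`, and `pop`
recovers the assignment to the other variables. -/
theorem ex {P : (ℕ → ℕ) → ℕ → Prop} (hP : IsSigma fun e => P (pop e) (e 0)) :
    IsSigma fun e => ∃ a, P e a := by
  obtain ⟨δ, hδ⟩ := hP
  -- the outer quantifier bounds `a` and the witness for `a`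
  refine ⟨.exLE 0 (.exLE 1 (δ.rename (liftRenaming (liftRenaming Nat.succ)))), fun e => ?_⟩
  simp only [Holds, holds_rename, push_comp_liftRenaming]
  have h : ∀ a, P e a ↔ ∃ x, δ.Holds (push x (push a e)) := fun a => hδ (push a e)
  simp only [h]
  constructor
  · rintro ⟨a, x, hx⟩
    exact ⟨max x a, a, le_max_right x a, x, le_max_left x a, hx⟩
  · rintro ⟨_, a, _, x, _, hx⟩
    exact ⟨a, x, hx⟩

/-- `Σ⁰₁`-definable predicates are closed under bounded universal quantification, by collection
in `ℕ`: finitely many witnesses have a common bound. -/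
theorem ball {P : (ℕ → ℕ) → ℕ → Prop} (v : ℕ) (hP : IsSigma fun e => P (pop e) (e 0)) :
    IsSigma fun e => ∀ a < e v, P e a := by
  obtain ⟨δ, hδ⟩ := hP
  refine ⟨.allLT (v + 1) (.exLE 1 (δ.rename (liftRenaming (liftRenaming Nat.succ)))), fun e => ?_⟩
  simp only [Holds, holds_rename, push_comp_liftRenaming]
  have h : ∀ a, P e a ↔ ∃ x, δ.Holds (push x (push a e)) := fun a => hδ (push a e)
  simp only [h]
  constructor
  · intro H
    choose! w hw using H
    refine ⟨(Finset.range (e v)).sup w, fun a ha => ⟨w a, ?_, hw a ha⟩⟩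
    exact Finset.le_sup (f := w) (Finset.mem_range.2 ha)
  · rintro ⟨b, H⟩ a ha
    obtain ⟨x, _, hx⟩ := H a ha
    exact ⟨x, hx⟩

theorem rename (hP : IsSigma P) (r : ℕ → ℕ) : IsSigma fun e => P (e ∘ r) := by
  obtain ⟨δ, hδ⟩ := hP
  refine ⟨δ.rename (liftRenaming r), fun e => ?_⟩
  simp only [hδ, holds_rename, push_comp_liftRenaming]

end IsSigma

/-- The functions of assignments with `Σ⁰₁`-definable graph. In the graph the variable `0` stands for
the value and the other variables for the arguments. -/
def IsSigmaFun (f : (ℕ → ℕ) → ℕ) : Prop := IsSigma fun e => e 0 = f (pop e)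

namespace IsSigmaFun

variable {f g : (ℕ → ℕ) → ℕ}

theorem pop (hf : IsSigmaFun f) : IsSigmaFun fun e => f (pop e) :=
  (IsSigma.rename hf (liftRenaming Nat.succ)).of_eq fun _ => Iff.rfl

theorem var (u : ℕ) : IsSigmaFun fun e => e u := by
  -- `a = b` is expressed as `¬ a < b ∧ ¬ b < a`
  refine (IsSigma.of_delta (.and (.neg (.lt 0 (u + 1))) (.neg (.lt (u + 1) 0)))).of_eq fun e => ?_
  simp only [Holds, SigmaRep.pop]
  omega

end IsSigmaFun

/-- Substitution of a definable function for the variable of innermost index. -/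
theorem IsSigma.subst {P : (ℕ → ℕ) → ℕ → Prop} {f : (ℕ → ℕ) → ℕ}
    (hP : IsSigma fun e => P (pop e) (e 0)) (hf : IsSigmaFun f) : IsSigma fun e => P e (f e) := by
  refine (IsSigma.ex (P := fun e a => a = f e ∧ P e a) (IsSigma.and hf hP)).of_eq fun e => ?_
  simp

/-- Definable functions may be substituted for both arguments of a definable relation. -/
theorem IsSigma.subst₂ {R : ℕ → ℕ → Prop} {f g : (ℕ → ℕ) → ℕ}
    (hR : IsSigma fun e => R (e 0) (e 1)) (hf : IsSigmaFun f) (hg : IsSigmaFun g) :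
    IsSigma fun e => R (f e) (g e) := by
  refine IsSigma.subst (P := fun e a => R a (g e)) ?_ hf
  exact IsSigma.subst (P := fun e b => R (e 0) b) (hR.rename fun i => if i = 0 then 1 else 0) hg.pop

theorem IsSigma.lt {f g : (ℕ → ℕ) → ℕ} (hf : IsSigmaFun f) (hg : IsSigmaFun g) :
    IsSigma fun e => f e < g e :=
  IsSigma.subst₂ (R := fun a b => a < b) (IsSigma.of_delta (.lt 0 1)) hf hg

theorem IsSigma.eq {f g : (ℕ → ℕ) → ℕ} (hf : IsSigmaFun f) (hg : IsSigmaFun g) :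
    IsSigma fun e => f e = g e :=
  IsSigma.subst₂ (R := fun a b => a = b) (IsSigmaFun.var 0) hf hg

namespace IsSigmaFun

variable {f g : (ℕ → ℕ) → ℕ}

/-- A function of two arguments with definable graph may be applied to definable functions. -/
theorem comp₂ {F : ℕ → ℕ → ℕ} (hF : IsSigma fun e => e 0 = F (e 1) (e 2)) (hf : IsSigmaFun f)
    (hg : IsSigmaFun g) : IsSigmaFun fun e => F (f e) (g e) := by
  refine IsSigma.subst (P := fun e a => e 0 = F a (g (SigmaRep.pop e))) ?_ hf.pop
  refine IsSigma.subst (P := fun e b => e 1 = F (e 0) b) ?_ hg.pop.pop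
  exact hF.rename fun i => if i = 0 then 2 else if i = 1 then 1 else 0

theorem add (hf : IsSigmaFun f) (hg : IsSigmaFun g) : IsSigmaFun fun e => f e + g e :=
  comp₂ ((IsSigma.of_delta (.add 1 2 0)).of_eq fun _ => eq_comm) hf hg

theorem mul (hf : IsSigmaFun f) (hg : IsSigmaFun g) : IsSigmaFun fun e => f e * g e :=
  comp₂ ((IsSigma.of_delta (.mul 1 2 0)).of_eq fun _ => eq_comm) hf hg

theorem zero : IsSigmaFun fun _ => 0 :=
  (IsSigma.of_delta (.zero 0)).of_eq fun _ => eq_comm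

theorem succ (hf : IsSigmaFun f) : IsSigmaFun fun e => f e + 1 :=
  IsSigma.subst (P := fun e a => e 0 = a + 1)
    ((IsSigma.of_delta (.succ 0 1)).of_eq fun _ => eq_comm) hf.pop

theorem natPair (hf : IsSigmaFun f) (hg : IsSigmaFun g) :
    IsSigmaFun fun e => Nat.pair (f e) (g e) := by
  refine comp₂ ?_ hf hg
  refine (IsSigma.or
    (((IsSigma.lt (var 1) (var 2))).and (IsSigma.eq (var 0) (((var 2).mul (var 2)).add (var 1))))
    ((IsSigma.lt (var 2) (var 1).succ).and
      (IsSigma.eq (var 0) ((((var 1).mul (var 1)).add (var 1)).add (var 2))))).of_eq fun e => ?_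
  rw [Nat.pair]
  split <;> omega

theorem beta (hf : IsSigmaFun f) (hg : IsSigmaFun g) :
    IsSigmaFun fun e => Nat.beta (f e) (g e) := by
  refine comp₂ ?_ hf hg
  have hm : ∀ i j : ℕ, IsSigmaFun fun e => (e i + 1) * e j + 1 := fun i j =>
    ((var i).succ.mul (var j)).succ
  -- `v = p % m` if and only if `v < m` and `p = v + k * m` for some `k`
  refine (IsSigma.ex (P := fun e p => ∃ q k, e 1 = Nat.pair p q ∧
    e 0 < (e 2 + 1) * q + 1 ∧ p = e 0 + k * ((e 2 + 1) * q + 1)) ?_).of_eq fun e => ?_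
  · refine IsSigma.ex (P := fun e q => ∃ k, e 2 = Nat.pair (e 0) q ∧
      e 1 < (e 3 + 1) * q + 1 ∧ e 0 = e 1 + k * ((e 3 + 1) * q + 1)) ?_
    refine IsSigma.ex (P := fun e k => e 3 = Nat.pair (e 1) (e 0) ∧
      e 2 < (e 4 + 1) * e 0 + 1 ∧ e 1 = e 2 + k * ((e 4 + 1) * e 0 + 1)) ?_
    exact (IsSigma.eq (var 4) ((var 2).natPair (var 1))).and
      ((IsSigma.lt (var 3) (hm 5 1)).and
        (IsSigma.eq (var 2) ((var 3).add ((var 0).mul (hm 5 1)))))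
  · rw [Nat.beta]
    constructor
    · rintro ⟨p, q, k, h1, h2, h3⟩
      rw [h1, Nat.unpair_pair]
      simp only
      rw [h3, Nat.add_mul_mod_self_right, Nat.mod_eq_of_lt h2]
    · intro h
      refine ⟨(e 1).unpair.1, (e 1).unpair.2,
        (e 1).unpair.1 / ((e 2 + 1) * (e 1).unpair.2 + 1), (Nat.pair_unpair _).symm, ?_, ?_⟩
      · rw [h]; exact Nat.mod_lt _ (Nat.succ_pos _)
      · rw [h]; exact (Nat.mod_add_div' _ _).symm

end IsSigmaFun

/-- Unpairing of the variable `0`: the two components are quantified, the second one innermost. -/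
theorem IsSigma.ex_natPair {R : ℕ → ℕ → ℕ → Prop}
    (hR : IsSigma fun e => R (e 1) (e 0) (e 2)) :
    IsSigma fun e => R (e 0).unpair.1 (e 0).unpair.2 (e 1) := by
  refine (IsSigma.ex (P := fun e a => ∃ b, e 0 = Nat.pair a b ∧ R a b (e 1)) ?_).of_eq fun e => ?_
  · refine IsSigma.ex (P := fun e b => e 1 = Nat.pair (e 0) b ∧ R (e 0) b (e 2)) ?_
    exact (IsSigma.eq (.var 2) ((IsSigmaFun.var 1).natPair (.var 0))).and
      (hR.rename fun i => if i = 2 then 3 else i)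
  · constructor
    · rintro ⟨a, b, h, hr⟩
      rw [h, Nat.unpair_pair]; exact hr
    · intro h
      exact ⟨_, _, (Nat.pair_unpair _).symm, h⟩

/-- Primitive recursion has a definable graph: the values of a recursion are coded by Gödel's
`β`-function. -/
theorem mem_natRec_iff_exists_beta (f : ℕ →. ℕ) (g : ℕ →. ℕ) (a n v : ℕ) :
    (v ∈ (n.rec (f a) fun y IH => IH.bind fun i => g (Nat.pair a (Nat.pair y i)) : Part ℕ)) ↔
      ∃ s, Nat.beta s 0 ∈ f a ∧
        (∀ y < n, Nat.beta s (y + 1) ∈ g (Nat.pair a (Nat.pair y (Nat.beta s y)))) ∧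
        v = Nat.beta s n := by
  constructor
  · intro hv
    have hist : ∀ (n v : ℕ),
        (v ∈ (n.rec (f a) fun y IH => IH.bind fun i => g (Nat.pair a (Nat.pair y i)) : Part ℕ)) →
        ∃ h : ℕ → ℕ, h 0 ∈ f a ∧ (∀ y < n, h (y + 1) ∈ g (Nat.pair a (Nat.pair y (h y)))) ∧
          h n = v := by
      intro n
      induction n with
      | zero => intro v hv; exact ⟨fun _ => v, hv, by simp, rfl⟩
      | succ n ih =>
        intro v hv
        obtain ⟨i, hi, hv⟩ := Part.mem_bind_iff.1 hv
        obtain ⟨h, h0, hs, hn⟩ := ih i hi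
        refine ⟨fun m => if m = n + 1 then v else h m, by simpa using h0, fun y hy => ?_, by simp⟩
        rcases Nat.lt_succ_iff_lt_or_eq.1 hy with hy | rfl
        · simpa [show y ≠ n by omega, show y ≠ n + 1 by omega] using hs y hy
        · simpa [hn] using hv
    obtain ⟨h, h0, hs, hn⟩ := hist n v hv
    have hb : ∀ i ≤ n, Nat.beta (Nat.unbeta ((List.range (n + 1)).map h)) i = h i := by
      intro i hi
      have := Nat.beta_unbeta_coe ((List.range (n + 1)).map h)
        ⟨i, by simpa using Nat.lt_succ_of_le hi⟩
      simpa using this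
    refine ⟨Nat.unbeta ((List.range (n + 1)).map h), ?_, fun y hy => ?_, ?_⟩
    · rwa [hb 0 (Nat.zero_le n)]
    · rw [hb _ hy, hb _ hy.le]; exact hs y hy
    · rw [hb n le_rfl, hn]
  · rintro ⟨s, h0, hs, rfl⟩
    have : ∀ m ≤ n, Nat.beta s m ∈
        (m.rec (f a) fun y IH => IH.bind fun i => g (Nat.pair a (Nat.pair y i)) : Part ℕ) := by
      intro m
      induction m with
      | zero => intro _; exact h0
      | succ m ih => intro hm; exact Part.mem_bind_iff.2 ⟨_, ih (Nat.le_of_succ_le hm), hs m hm⟩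
    exact this n le_rfl

/-- Partial recursive functions have `Σ⁰₁`-definable graphs. -/
theorem isSigma_of_partrec {f : ℕ →. ℕ} (hf : Nat.Partrec f) :
    IsSigma fun e => e 1 ∈ f (e 0) := by
  have v := IsSigmaFun.var
  induction hf with
  | zero =>
    refine (IsSigma.eq (v 1) .zero).of_eq fun e => ?_
    exact Part.mem_some_iff.symm
  | succ =>
    refine (IsSigma.eq (v 1) (v 0).succ).of_eq fun e => ?_
    simp
  | left =>
    refine (IsSigma.ex_natPair (R := fun a _ c => c = a) (IsSigma.eq (v 2) (v 1))).of_eq fun e => ?_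
    simp
  | right =>
    refine (IsSigma.ex_natPair (R := fun _ b c => c = b) (IsSigma.eq (v 2) (v 0))).of_eq fun e => ?_
    simp
  | @pair f g _ _ ihf ihg =>
    refine (IsSigma.ex (P := fun e a => ∃ b, a ∈ f (e 0) ∧ b ∈ g (e 0) ∧ e 1 = Nat.pair a b)
      ?_).of_eq fun e => ?_
    · refine IsSigma.ex (P := fun e b => e 0 ∈ f (e 1) ∧ b ∈ g (e 1) ∧ e 2 = Nat.pair (e 0) b) ?_
      exact (ihf.subst₂ (R := fun x y => y ∈ f x) (v 2) (v 1)).and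
        ((ihg.subst₂ (R := fun x y => y ∈ g x) (v 2) (v 0)).and
          (IsSigma.eq (v 3) ((v 1).natPair (v 0))))
    · simp [Seq.seq, eq_comm]
  | @comp f g _ _ ihf ihg =>
    refine (IsSigma.ex (P := fun e b => b ∈ g (e 0) ∧ e 1 ∈ f b) ?_).of_eq fun e => ?_
    · exact (ihg.subst₂ (R := fun x y => y ∈ g x) (v 1) (v 0)).and
        (ihf.subst₂ (R := fun x y => y ∈ f x) (v 0) (v 2))
    · exact Part.mem_bind_iff.symm
  | @prec f g _ _ ihf ihg =>
    refine (IsSigma.ex_natPair (R := fun a n c => ∃ s, Nat.beta s 0 ∈ f a ∧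
        (∀ y < n, Nat.beta s (y + 1) ∈ g (Nat.pair a (Nat.pair y (Nat.beta s y)))) ∧
        c = Nat.beta s n) ?_).of_eq fun e => ?_
    · refine IsSigma.ex (P := fun e s => Nat.beta s 0 ∈ f (e 1) ∧
        (∀ y < e 0, Nat.beta s (y + 1) ∈ g (Nat.pair (e 1) (Nat.pair y (Nat.beta s y)))) ∧
        e 2 = Nat.beta s (e 0)) ?_
      refine (ihf.subst₂ (R := fun x y => y ∈ f x) (v 2) ((v 0).beta .zero)).and
        (IsSigma.and ?_ (IsSigma.eq (v 3) ((v 0).beta (v 1))))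
      refine IsSigma.ball (P := fun e y => Nat.beta (e 0) (y + 1) ∈
        g (Nat.pair (e 2) (Nat.pair y (Nat.beta (e 0) y)))) 1 ?_
      exact ihg.subst₂ (R := fun x y => y ∈ g x)
        ((v 3).natPair ((v 0).natPair ((v 1).beta (v 0)))) ((v 1).beta (v 0).succ)
    · exact (mem_natRec_iff_exists_beta f g _ _ _).symm
  | @rfind f _ ihf =>
    refine (IsSigma.and (P := fun e => 0 ∈ f (Nat.pair (e 0) (e 1)))
      (Q := fun e => ∀ m < e 1, ∃ k, k + 1 ∈ f (Nat.pair (e 0) m)) ?_ ?_).of_eq fun e => ?_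
    · exact ihf.subst₂ (R := fun x y => y ∈ f x) ((v 0).natPair (v 1)) .zero
    · refine IsSigma.ball (P := fun e m => ∃ k, k + 1 ∈ f (Nat.pair (e 0) m)) 1 ?_
      refine IsSigma.ex (P := fun e k => k + 1 ∈ f (Nat.pair (e 1) (e 0))) ?_
      exact ihf.subst₂ (R := fun x y => y ∈ f x) ((v 2).natPair (v 1)) (v 0).succ
    · refine Iff.trans ?_ Nat.mem_rfind.symm
      simp only [Part.map_eq_map, Part.mem_map_iff]
      refine and_congr (by simp) (forall₂_congr fun m _ => ?_)
      constructor
      · rintro ⟨k, hk⟩; exact ⟨k + 1, hk, by simp⟩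
      · rintro ⟨k, hk, h⟩
        cases k with
        | zero => simp at h
        | succ k => exact ⟨k, hk⟩

/-- A pure `Δ₀`-formula that says that the variable `0` has the value `n`. -/
def numeralFormula : ℕ → PureDelta
  | 0 => .zero 0
  | n + 1 => .exLT 0 (.and (.succ 0 1) (numeralFormula n))

theorem holds_numeralFormula (n : ℕ) : ∀ e, (numeralFormula n).Holds e ↔ e 0 = n := by
  induction n with
  | zero => intro e; exact eq_comm
  | succ n ih =>
    intro e
    simp only [numeralFormula, Holds, ih]
    constructor
    · rintro ⟨a, _, h1, h2⟩
      change a + 1 = e 0 at h1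
      change a = n at h2
      omega
    · intro h
      exact ⟨n, by omega, h.symm, rfl⟩

theorem scoped_numeralFormula (n : ℕ) : (numeralFormula n).Scoped 1 := by
  induction n with
  | zero => exact Nat.one_pos
  | succ n ih => exact ⟨Nat.one_pos, ⟨Nat.two_pos, Nat.one_lt_two⟩, ih.mono (Nat.le_succ 1)⟩

theorem computable_code_numeralFormula : Computable fun n => (numeralFormula n).code := by
  have h : Computable₂ fun (_ : ℕ) (y : ℕ × ℕ) =>
      Nat.pair 12 (Nat.pair 0 (Nat.pair 8 (Nat.pair (Nat.pair 4 (Nat.pair 0 1)) y.2))) := by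
    unfold Computable₂; fun_prop
  refine (Computable.nat_rec computable_id (computable_const (Nat.pair 3 0)) h).of_eq fun n => ?_
  induction n with
  | zero => rfl
  | succ n ih =>
    simp only at ih
    simp only [ih]
    rfl

/-- Every recursively enumerable set of numbers is represented in `ℕ` by pure 1-`Σ⁰₁`-sentences,
recursively in the number. -/
theorem exists_pureSigma_of_rePred {A : ℕ → Prop} (hA : REPred A) :
    ∃ s : ℕ → PureSigma, (Computable fun n => (s n).code) ∧ ∀ n, (s n).IsTrue ↔ A n := by
  have hpart : Nat.Partrec fun n => (Part.assert (A n) fun _ => Part.some ()).map fun _ => 0 :=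
    Partrec.nat_iff.1 (Partrec.map hA (Computable.const 0))
  obtain ⟨δ, hδ⟩ := IsSigma.subst₂ (R := fun x y => y ∈
    (Part.assert (A x) fun _ => Part.some ()).map fun _ => 0) (isSigma_of_partrec hpart)
    (.var 0) .zero
  have hAδ : ∀ e, A (e 0) ↔ ∃ x, δ.Holds (push x e) := fun e => by
    rw [← hδ e]; simp
  -- the witness of `δ` has index `0`, the number `n` has index `1`
  have hsc : (δ.rename fun i => if i = 0 then 0 else 1).Scoped 2 :=
    scoped_rename fun i => by split <;> omega
  refine ⟨fun n => ⟨.exLE 0 (.and (numeralFormula n)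
    (.exLE 1 (δ.rename fun i => if i = 0 then 0 else 1))), Nat.one_pos,
    (scoped_numeralFormula n).mono (Nat.le_succ 1), Nat.one_lt_two, hsc.mono (Nat.le_succ 2)⟩,
    ?_, fun n => ?_⟩
  · have := computable_code_numeralFormula
    simp only [PureSigma.code, PureDelta.code]
    fun_prop
  · simp only [PureSigma.IsTrue, Holds, holds_numeralFormula, holds_rename]
    have key : ∀ y x b : ℕ, (push y (push x (push b fun _ => 0)) ∘ fun i => if i = 0 then 0 else 1)
        = push y fun _ => x := by
      intro y x b; funext i; cases i <;> rfl
    simp only [key]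
    rw [hAδ fun _ => n]
    constructor
    · rintro ⟨b, x, _, rfl, y, _, h⟩
      exact ⟨y, h⟩
    · rintro ⟨y, h⟩
      exact ⟨max y n, n, le_max_right y n, rfl, y, le_max_left y n, h⟩

end Definability

/-! ### Gödel numbers of terms and formulas -/

section Codes

variable {L : FirstOrder.Language.{u, v}}

theorem Consistent.not_proves_not {T : L.Theory} (hT : Consistent T) {φ : L.Sentence}
    (h : Proves T φ) : ¬ Proves T φ.not := fun h' => hT (Derivable.mp h' h)

variable [Encodable (Σ n, L.Functions n)]

theorem encode_listOfFn_injective {n : ℕ} {f g : Fin n → ℕ}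
    (h : Encodable.encode (List.ofFn f) = Encodable.encode (List.ofFn g)) : f = g :=
  List.ofFn_injective (Encodable.encode_injective h)

theorem termCode_injective {β : Type w} [Encodable β] :
    Function.Injective (termCode : L.Term β → ℕ) := by
  intro s
  induction s with
  | var b =>
    intro t h
    cases t with
    | var c =>
      simp only [termCode, Nat.pair_eq_pair, true_and] at h
      rw [Encodable.encode_injective h]
    | func g us => simp [termCode, Nat.pair_eq_pair] at h
  | @func n f ts ih =>
    intro t h
    cases t with
    | var c => simp [termCode, Nat.pair_eq_pair] at h
    | @func m g us =>
      simp only [termCode, Nat.pair_eq_pair, true_and] at h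
      obtain ⟨rfl, hfg⟩ := Sigma.mk.inj (Encodable.encode_injective h.1)
      obtain rfl := eq_of_heq hfg
      have := encode_listOfFn_injective h.2
      congr 1
      funext i
      exact ih i (congrFun this i)

/-- The number of a term over the free variables, regarded as a term of a formula. -/
def freeTermCode (t : L.Term ℕ) : ℕ := termCode (t.relabel (Sum.inl : ℕ → ℕ ⊕ Fin 0))

theorem termCode_relabel_inl (t : L.Term ℕ) (k : ℕ) :
    termCode (t.relabel (Sum.inl : ℕ → ℕ ⊕ Fin k)) = freeTermCode t := by
  unfold freeTermCode
  induction t with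
  | var a => simp [termCode]
  | func f ts ih => simp only [Term.relabel, termCode, ih]

theorem exists_freeTermCode (t : L.Term (ℕ ⊕ Fin 0)) :
    ∃ s : L.Term ℕ, freeTermCode s = termCode t := by
  refine ⟨t.relabel (Sum.elim id Fin.elim0), ?_⟩
  unfold freeTermCode
  congr 1
  rw [Term.relabel_relabel]
  convert Term.relabel_id t
  funext i
  rcases i with i | i
  · rfl
  · exact i.elim0

theorem freeTermCode_var (x : ℕ) : freeTermCode (Term.var x : L.Term ℕ) = Nat.pair 0 (2 * x) := rfl

variable [Encodable (Σ n, L.Relations n)]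

theorem formulaCode_injective {α : Type w} [Encodable α] {n : ℕ} :
    Function.Injective (formulaCode : L.BoundedFormula α n → ℕ) := by
  intro φ
  induction φ with
  | falsum => intro ψ h; cases ψ <;> simp_all [formulaCode, Nat.pair_eq_pair]
  | equal s t =>
    intro ψ h
    cases ψ <;> simp only [formulaCode, Nat.pair_eq_pair] at h <;> try omega
    rw [termCode_injective h.2.1, termCode_injective h.2.2]
  | @rel n l R ts =>
    intro ψ h
    cases ψ <;> simp only [formulaCode, Nat.pair_eq_pair] at h <;> try omega
    obtain ⟨rfl, hR⟩ := Sigma.mk.inj (Encodable.encode_injective h.2.1)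
    obtain rfl := eq_of_heq hR
    congr 1
    funext i
    exact termCode_injective (congrFun (encode_listOfFn_injective h.2.2) i)
  | imp φ₁ φ₂ ih₁ ih₂ =>
    intro ψ h
    cases ψ <;> simp only [formulaCode, Nat.pair_eq_pair] at h <;> try omega
    rw [ih₁ h.2.1, ih₂ h.2.2]
  | all φ ih =>
    intro ψ h
    cases ψ <;> simp only [formulaCode, Nat.pair_eq_pair] at h <;> try omega
    rw [ih h.2]

/-- A variable of a sentence and the variable of the same name over the free variables `ℕ` have the
same number, so a sentence keeps its Gödel number as a formula over the free variables `ℕ`. -/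
theorem formulaCode_ofSentence (σ : L.Sentence) : formulaCode (ofSentence σ) = sentenceCode σ := by
  have hterm : ∀ {k : ℕ} (t : L.Term (Empty ⊕ Fin k)),
      termCode (t.subst (Sum.elim (Term.relabel Sum.inl ∘ fun a : Empty => a.elim)
        (Term.var ∘ Sum.inr)) : L.Term (ℕ ⊕ Fin k)) = termCode t := by
    intro k t
    induction t with
    | var b =>
      rcases b with b | b
      · exact b.elim
      · simp [Term.subst, termCode]
    | func f ts ih => simp only [Term.subst, termCode, ih]
  have hform : ∀ {k : ℕ} (φ : L.BoundedFormula Empty k),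
      formulaCode (BoundedFormula.subst φ fun a : Empty => (a.elim : L.Term ℕ)) =
        formulaCode φ := by
    intro k φ
    unfold BoundedFormula.subst
    induction φ with
    | falsum => rfl
    | equal s t => simp only [BoundedFormula.mapTermRel, formulaCode, hterm]
    | rel R ts => simp only [BoundedFormula.mapTermRel, formulaCode, hterm]; rfl
    | imp φ ψ ih₁ ih₂ => simp only [BoundedFormula.mapTermRel, formulaCode, ih₁, ih₂]
    | all φ ih => simp only [BoundedFormula.mapTermRel, formulaCode]; exact congrArg _ ih
  exact hform σ

theorem sentenceCode_not (φ : L.Sentence) :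
    sentenceCode φ.not = Nat.pair 3 (Nat.pair (sentenceCode φ) (Nat.pair 0 0)) := rfl

theorem formulaCode_equal (s t : L.Term ℕ) :
    formulaCode (s.equal t) = Nat.pair 1 (Nat.pair (freeTermCode s) (freeTermCode t)) := rfl

end Codes

/-! ### Derivability as a Horn closure on Gödel numbers -/

section Rules

variable (L : FirstOrder.Language.{u, v})

/-- `g` is the number of a function symbol of arity `m`. -/
def IsFunctionCode [Encodable (Σ n, L.Functions n)] (m g : ℕ) : Prop :=
  ∃ f : L.Functions m, Encodable.encode (⟨m, f⟩ : Σ n, L.Functions n) = g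

/-- `g` is the number of a relation symbol of arity `m`. -/
def IsRelationCode [Encodable (Σ n, L.Relations n)] (m g : ℕ) : Prop :=
  ∃ R : L.Relations m, Encodable.encode (⟨m, R⟩ : Σ n, L.Relations n) = g

variable {L} in
theorem rePred_isFunctionCode [Encodable (Σ n, L.Functions n)] [Finite (Σ n, L.Functions n)]
    {α : Type*} [Primcodable α] {f g : α → ℕ} (hf : Computable f) (hg : Computable g) :
    REPred fun a => IsFunctionCode L (f a) (g a) := by
  refine REPred.preimage (p := fun x : ℕ × ℕ => IsFunctionCode L x.1 x.2)
    (rePred_of_finite ?_) (hf.pair hg)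
  refine (Set.finite_range fun s : Σ n, L.Functions n => (s.1, Encodable.encode s)).subset ?_
  rintro ⟨m, g⟩ ⟨f, hfg⟩
  exact ⟨⟨m, f⟩, Prod.ext rfl hfg⟩

variable {L} in
theorem rePred_isRelationCode [Encodable (Σ n, L.Relations n)] [Finite (Σ n, L.Relations n)]
    {α : Type*} [Primcodable α] {f g : α → ℕ} (hf : Computable f) (hg : Computable g) :
    REPred fun a => IsRelationCode L (f a) (g a) := by
  refine REPred.preimage (p := fun x : ℕ × ℕ => IsRelationCode L x.1 x.2)
    (rePred_of_finite ?_) (hf.pair hg)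
  refine (Set.finite_range fun s : Σ n, L.Relations n => (s.1, Encodable.encode s)).subset ?_
  rintro ⟨m, g⟩ ⟨f, hfg⟩
  exact ⟨⟨m, f⟩, Prod.ext rfl hfg⟩

variable [Encodable (Σ n, L.Functions n)] [Encodable (Σ n, L.Relations n)]

/-- Rules that generate the numbers of the terms and formulas with `k` bound variables in which the
free variable `x` does not occur: `[0, x, k, s]` says this of the term number `s`,
`[1, x, k, m, l]` of the number `l` of a list of `m` terms, and `[2, x, k, p]` of the formula
number `p`. -/
inductive FreshRule : List (List ℕ) → List ℕ → Prop
  | free (x k a : ℕ) : x < a ∨ a < x → FreshRule [] [0, x, k, Nat.pair 0 (2 * a)]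
  | bound (x k i : ℕ) : i < k → FreshRule [] [0, x, k, Nat.pair 0 (2 * i + 1)]
  | func (x k m g l : ℕ) : IsFunctionCode L m g →
      FreshRule [ [1, x, k, m, l] ] [0, x, k, Nat.pair 1 (Nat.pair g l)]
  | nil (x k : ℕ) : FreshRule [] [1, x, k, 0, 0]
  | cons (x k m s l : ℕ) :
      FreshRule [ [0, x, k, s], [1, x, k, m, l] ] [1, x, k, m + 1, Nat.pair s l + 1]
  | falsum (x k : ℕ) : FreshRule [] [2, x, k, Nat.pair 0 0]
  | equal (x k s t : ℕ) :
      FreshRule [ [0, x, k, s], [0, x, k, t] ] [2, x, k, Nat.pair 1 (Nat.pair s t)]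
  | rel (x k m g l : ℕ) : IsRelationCode L m g →
      FreshRule [ [1, x, k, m, l] ] [2, x, k, Nat.pair 2 (Nat.pair g l)]
  | imp (x k p q : ℕ) :
      FreshRule [ [2, x, k, p], [2, x, k, q] ] [2, x, k, Nat.pair 3 (Nat.pair p q)]
  | all (x k p : ℕ) : FreshRule [ [2, x, k + 1, p] ] [2, x, k, Nat.pair 4 p]

/-- Rules that generate the graph of `instantiate` on numbers, where `t` is the number of the
instantiating term: `[3, t, k, s, s']` for a term with `k + 1` bound variables,
`[4, t, k, m, l, l']` for a list of `m` such terms, and `[5, t, k, p, q]` for a formula. -/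
inductive InstRule : List (List ℕ) → List ℕ → Prop
  | free (t k a : ℕ) : InstRule [] [3, t, k, Nat.pair 0 (2 * a), Nat.pair 0 (2 * a)]
  | zero (t k : ℕ) : InstRule [] [3, t, k, Nat.pair 0 1, t]
  | succ (t k i : ℕ) : i < k →
      InstRule [] [3, t, k, Nat.pair 0 (2 * (i + 1) + 1), Nat.pair 0 (2 * i + 1)]
  | func (t k m g l l' : ℕ) : IsFunctionCode L m g →
      InstRule [ [4, t, k, m, l, l'] ]
        [3, t, k, Nat.pair 1 (Nat.pair g l), Nat.pair 1 (Nat.pair g l')]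
  | nil (t k : ℕ) : InstRule [] [4, t, k, 0, 0, 0]
  | cons (t k m s s' l l' : ℕ) :
      InstRule [ [3, t, k, s, s'], [4, t, k, m, l, l'] ]
        [4, t, k, m + 1, Nat.pair s l + 1, Nat.pair s' l' + 1]
  | falsum (t k : ℕ) : InstRule [] [5, t, k, Nat.pair 0 0, Nat.pair 0 0]
  | equal (t k s s' r r' : ℕ) :
      InstRule [ [3, t, k, s, s'], [3, t, k, r, r'] ]
        [5, t, k, Nat.pair 1 (Nat.pair s r), Nat.pair 1 (Nat.pair s' r')]
  | rel (t k m g l l' : ℕ) : IsRelationCode L m g →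
      InstRule [ [4, t, k, m, l, l'] ]
        [5, t, k, Nat.pair 2 (Nat.pair g l), Nat.pair 2 (Nat.pair g l')]
  | imp (t k p p' q q' : ℕ) :
      InstRule [ [5, t, k, p, p'], [5, t, k, q, q'] ]
        [5, t, k, Nat.pair 3 (Nat.pair p q), Nat.pair 3 (Nat.pair p' q')]
  | all (t k p p' : ℕ) :
      InstRule [ [5, t, k + 1, p, p'] ] [5, t, k, Nat.pair 4 p, Nat.pair 4 p']

variable {L}

/-- Rules that generate the numbers of the derivable formulas: `[6, p]` says that `p` is one. The
premises `[2, x, 0, p]` only serve to say that `p` is the number of a formula. -/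
inductive DerivRule (T : L.Theory) : List (List ℕ) → List ℕ → Prop
  | hyp (p : ℕ) : (∃ φ ∈ T, sentenceCode φ = p) → DerivRule T [] [6, p]
  | axK (x y p q : ℕ) :
      DerivRule T [ [2, x, 0, p], [2, y, 0, q] ]
        [6, Nat.pair 3 (Nat.pair p (Nat.pair 3 (Nat.pair q p)))]
  | axS (x y z p q r : ℕ) :
      DerivRule T [ [2, x, 0, p], [2, y, 0, q], [2, z, 0, r] ]
        [6, Nat.pair 3 (Nat.pair
          (Nat.pair 3 (Nat.pair p (Nat.pair 3 (Nat.pair q r))))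
          (Nat.pair 3 (Nat.pair (Nat.pair 3 (Nat.pair p q)) (Nat.pair 3 (Nat.pair p r)))))]
  | axDN (x p : ℕ) :
      DerivRule T [ [2, x, 0, p] ]
        [6, Nat.pair 3 (Nat.pair
          (Nat.pair 3 (Nat.pair (Nat.pair 3 (Nat.pair p (Nat.pair 0 0))) (Nat.pair 0 0))) p)]
  | mp (p q : ℕ) : DerivRule T [ [6, Nat.pair 3 (Nat.pair p q)], [6, p] ] [6, q]
  | axInst (x t p q : ℕ) :
      DerivRule T [ [0, x, 0, t], [5, t, 0, p, q] ]
        [6, Nat.pair 3 (Nat.pair (Nat.pair 4 p) q)]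
  | gen (x r p q : ℕ) :
      DerivRule T [ [2, x, 0, r], [2, x, 1, p], [5, Nat.pair 0 (2 * x), 0, p, q],
        [6, Nat.pair 3 (Nat.pair r q)] ] [6, Nat.pair 3 (Nat.pair r (Nat.pair 4 p))]
  | axRefl (x t : ℕ) : DerivRule T [ [0, x, 0, t] ] [6, Nat.pair 1 (Nat.pair t t)]
  | axLeibniz (x y s t p q q' : ℕ) :
      DerivRule T [ [0, x, 0, s], [0, y, 0, t], [5, s, 0, p, q], [5, t, 0, p, q'] ]
        [6, Nat.pair 3 (Nat.pair (Nat.pair 1 (Nat.pair s t)) (Nat.pair 3 (Nat.pair q q')))]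

/-- All rules for the syntax and the derivations of the theory `T`. -/
def SyntaxRule (T : L.Theory) (ps : List (List ℕ)) (c : List ℕ) : Prop :=
  FreshRule L ps c ∨ InstRule L ps c ∨ DerivRule T ps c

theorem rePred_freshRule [Finite (Σ n, L.Functions n)] [Finite (Σ n, L.Relations n)] :
    REPred fun x : List (List ℕ) × List ℕ => FreshRule L x.1 x.2 := by
  -- one disjunct for each rule
  have h : REPred fun y : List (List ℕ) × List ℕ =>
      (∃ x k a, (x < a ∨ a < x) ∧ y.1 = [] ∧ y.2 = [0, x, k, Nat.pair 0 (2 * a)]) ∨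
      (∃ x k i, i < k ∧ y.1 = [] ∧ y.2 = [0, x, k, Nat.pair 0 (2 * i + 1)]) ∨
      (∃ x k m g l, IsFunctionCode L m g ∧
        y.1 = [ [1, x, k, m, l] ] ∧ y.2 = [0, x, k, Nat.pair 1 (Nat.pair g l)]) ∨
      (∃ x k, y.1 = [] ∧ y.2 = [1, x, k, 0, 0]) ∨
      (∃ x k m s l, y.1 = [ [0, x, k, s], [1, x, k, m, l] ] ∧
        y.2 = [1, x, k, m + 1, Nat.pair s l + 1]) ∨
      (∃ x k, y.1 = [] ∧ y.2 = [2, x, k, Nat.pair 0 0]) ∨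
      (∃ x k s t, y.1 = [ [0, x, k, s], [0, x, k, t] ] ∧
        y.2 = [2, x, k, Nat.pair 1 (Nat.pair s t)]) ∨
      (∃ x k m g l, IsRelationCode L m g ∧
        y.1 = [ [1, x, k, m, l] ] ∧ y.2 = [2, x, k, Nat.pair 2 (Nat.pair g l)]) ∨
      (∃ x k p q, y.1 = [ [2, x, k, p], [2, x, k, q] ] ∧
        y.2 = [2, x, k, Nat.pair 3 (Nat.pair p q)]) ∨
      (∃ x k p, y.1 = [ [2, x, k + 1, p] ] ∧ y.2 = [2, x, k, Nat.pair 4 p]) := by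
    repeat' first
      | apply REPred.or | apply REPred.exists | apply REPred.and | apply rePred_eq
      | apply rePred_lt | apply rePred_isFunctionCode | apply rePred_isRelationCode
    all_goals fun_prop
  refine h.of_eq fun ⟨ps, c⟩ => ⟨fun h => ?_, fun h => by
    cases h with
    | free x k a h => exact Or.inl ⟨x, k, a, h, rfl, rfl⟩
    | _ => simp [*]⟩
  simp only at h
  rcases h with ⟨x, k, a, h, rfl, rfl⟩ | ⟨x, k, i, h, rfl, rfl⟩ | ⟨x, k, m, g, l, h, rfl, rfl⟩ |
    ⟨x, k, rfl, rfl⟩ | ⟨x, k, m, s, l, rfl, rfl⟩ | ⟨x, k, rfl, rfl⟩ | ⟨x, k, s, t, rfl, rfl⟩ |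
    ⟨x, k, m, g, l, h, rfl, rfl⟩ | ⟨x, k, p, q, rfl, rfl⟩ | ⟨x, k, p, rfl, rfl⟩
  exacts [.free x k a h, .bound x k i h, .func x k m g l h, .nil x k, .cons x k m s l, .falsum x k,
    .equal x k s t, .rel x k m g l h, .imp x k p q, .all x k p]

theorem rePred_instRule [Finite (Σ n, L.Functions n)] [Finite (Σ n, L.Relations n)] :
    REPred fun x : List (List ℕ) × List ℕ => InstRule L x.1 x.2 := by
  -- one disjunct for each rule
  have h : REPred fun y : List (List ℕ) × List ℕ =>
      (∃ t k a, y.1 = [] ∧ y.2 = [3, t, k, Nat.pair 0 (2 * a), Nat.pair 0 (2 * a)]) ∨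
      (∃ t k, y.1 = [] ∧ y.2 = [3, t, k, Nat.pair 0 1, t]) ∨
      (∃ t k i, i < k ∧ y.1 = [] ∧
        y.2 = [3, t, k, Nat.pair 0 (2 * (i + 1) + 1), Nat.pair 0 (2 * i + 1)]) ∨
      (∃ t k m g l l', IsFunctionCode L m g ∧ y.1 = [ [4, t, k, m, l, l'] ] ∧
        y.2 = [3, t, k, Nat.pair 1 (Nat.pair g l), Nat.pair 1 (Nat.pair g l')]) ∨
      (∃ t k, y.1 = [] ∧ y.2 = [4, t, k, 0, 0, 0]) ∨
      (∃ t k m s s' l l', y.1 = [ [3, t, k, s, s'], [4, t, k, m, l, l'] ] ∧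
        y.2 = [4, t, k, m + 1, Nat.pair s l + 1, Nat.pair s' l' + 1]) ∨
      (∃ t k, y.1 = [] ∧ y.2 = [5, t, k, Nat.pair 0 0, Nat.pair 0 0]) ∨
      (∃ t k s s' r r', y.1 = [ [3, t, k, s, s'], [3, t, k, r, r'] ] ∧
        y.2 = [5, t, k, Nat.pair 1 (Nat.pair s r), Nat.pair 1 (Nat.pair s' r')]) ∨
      (∃ t k m g l l', IsRelationCode L m g ∧ y.1 = [ [4, t, k, m, l, l'] ] ∧
        y.2 = [5, t, k, Nat.pair 2 (Nat.pair g l), Nat.pair 2 (Nat.pair g l')]) ∨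
      (∃ t k p p' q q', y.1 = [ [5, t, k, p, p'], [5, t, k, q, q'] ] ∧
        y.2 = [5, t, k, Nat.pair 3 (Nat.pair p q), Nat.pair 3 (Nat.pair p' q')]) ∨
      (∃ t k p p', y.1 = [ [5, t, k + 1, p, p'] ] ∧
        y.2 = [5, t, k, Nat.pair 4 p, Nat.pair 4 p']) := by
    repeat' first
      | apply REPred.or | apply REPred.exists | apply REPred.and | apply rePred_eq
      | apply rePred_lt | apply rePred_isFunctionCode | apply rePred_isRelationCode
    all_goals fun_prop
  refine h.of_eq fun ⟨ps, c⟩ => ⟨fun h => ?_, fun h => by cases h <;> simp [*]⟩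
  simp only at h
  rcases h with ⟨t, k, a, rfl, rfl⟩ | ⟨t, k, rfl, rfl⟩ | ⟨t, k, i, h, rfl, rfl⟩ |
    ⟨t, k, m, g, l, l', h, rfl, rfl⟩ | ⟨t, k, rfl, rfl⟩ | ⟨t, k, m, s, s', l, l', rfl, rfl⟩ |
    ⟨t, k, rfl, rfl⟩ | ⟨t, k, s, s', r, r', rfl, rfl⟩ | ⟨t, k, m, g, l, l', h, rfl, rfl⟩ |
    ⟨t, k, p, p', q, q', rfl, rfl⟩ | ⟨t, k, p, p', rfl, rfl⟩
  exacts [.free t k a, .zero t k, .succ t k i h, .func t k m g l l' h, .nil t k,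
    .cons t k m s s' l l', .falsum t k, .equal t k s s' r r', .rel t k m g l l' h,
    .imp t k p p' q q', .all t k p p']

theorem rePred_derivRule {T : L.Theory} (hT : IsRE T) :
    REPred fun x : List (List ℕ) × List ℕ => DerivRule T x.1 x.2 := by
  -- one disjunct for each rule
  have h : REPred fun y : List (List ℕ) × List ℕ =>
      (∃ p, (∃ φ ∈ T, sentenceCode φ = p) ∧ y.1 = [] ∧ y.2 = [6, p]) ∨
      (∃ x x' p q, y.1 = [ [2, x, 0, p], [2, x', 0, q] ] ∧
        y.2 = [6, Nat.pair 3 (Nat.pair p (Nat.pair 3 (Nat.pair q p)))]) ∨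
      (∃ x x' z p q r, y.1 = [ [2, x, 0, p], [2, x', 0, q], [2, z, 0, r] ] ∧
        y.2 = [6, Nat.pair 3 (Nat.pair
          (Nat.pair 3 (Nat.pair p (Nat.pair 3 (Nat.pair q r))))
          (Nat.pair 3 (Nat.pair (Nat.pair 3 (Nat.pair p q)) (Nat.pair 3 (Nat.pair p r)))))]) ∨
      (∃ x p, y.1 = [ [2, x, 0, p] ] ∧
        y.2 = [6, Nat.pair 3 (Nat.pair
          (Nat.pair 3 (Nat.pair (Nat.pair 3 (Nat.pair p (Nat.pair 0 0))) (Nat.pair 0 0))) p)]) ∨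
      (∃ p q, y.1 = [ [6, Nat.pair 3 (Nat.pair p q)], [6, p] ] ∧ y.2 = [6, q]) ∨
      (∃ x t p q, y.1 = [ [0, x, 0, t], [5, t, 0, p, q] ] ∧
        y.2 = [6, Nat.pair 3 (Nat.pair (Nat.pair 4 p) q)]) ∨
      (∃ x r p q, y.1 = [ [2, x, 0, r], [2, x, 1, p], [5, Nat.pair 0 (2 * x), 0, p, q],
        [6, Nat.pair 3 (Nat.pair r q)] ] ∧ y.2 = [6, Nat.pair 3 (Nat.pair r (Nat.pair 4 p))]) ∨
      (∃ x t, y.1 = [ [0, x, 0, t] ] ∧ y.2 = [6, Nat.pair 1 (Nat.pair t t)]) ∨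
      (∃ x x' s t p q q', y.1 = [ [0, x, 0, s], [0, x', 0, t], [5, s, 0, p, q], [5, t, 0, p, q'] ] ∧
        y.2 = [6, Nat.pair 3 (Nat.pair (Nat.pair 1 (Nat.pair s t))
          (Nat.pair 3 (Nat.pair q q')))]) := by
    refine REPred.or (REPred.exists (REPred.and (REPred.preimage hT Computable.snd) ?_)) ?_
    all_goals repeat' first
      | apply REPred.or | apply REPred.exists | apply REPred.and | apply rePred_eq
    all_goals fun_prop
  refine h.of_eq fun ⟨ps, c⟩ => ⟨fun h => ?_, fun h => by
    cases h with
    | hyp p h => exact Or.inl ⟨p, h, rfl, rfl⟩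
    | _ => simp⟩
  simp only at h
  rcases h with ⟨p, h, rfl, rfl⟩ | ⟨x, y, p, q, rfl, rfl⟩ | ⟨x, y, z, p, q, r, rfl, rfl⟩ |
    ⟨x, p, rfl, rfl⟩ | ⟨p, q, rfl, rfl⟩ | ⟨x, t, p, q, rfl, rfl⟩ | ⟨x, r, p, q, rfl, rfl⟩ |
    ⟨x, t, rfl, rfl⟩ | ⟨x, y, s, t, p, q, q', rfl, rfl⟩
  exacts [.hyp p h, .axK x y p q, .axS x y z p q r, .axDN x p, .mp p q, .axInst x t p q,
    .gen x r p q, .axRefl x t, .axLeibniz x y s t p q q']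

theorem rePred_closure_syntaxRule [Finite (Σ n, L.Functions n)] [Finite (Σ n, L.Relations n)]
    {T : L.Theory} (hT : IsRE T) : REPred (Closure (SyntaxRule T)) :=
  rePred_closure (rePred_freshRule.or (rePred_instRule.or (rePred_derivRule hT)))

end Rules

/-! ### The rules generate exactly the numbers of derivable formulas -/

section Adequacy

variable {L : FirstOrder.Language.{u, v}}
  [Encodable (Σ n, L.Functions n)] [Encodable (Σ n, L.Relations n)]

/-- The intended meaning of the statements that the rules of `SyntaxRule T` derive. The statements
about instantiation say nothing if `t` is not the number of a term. -/
def SyntaxMeaning (T : L.Theory) : List ℕ → Prop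
  | [0, x, k, s] => ∃ a : L.Term (ℕ ⊕ Fin k), x ∉ a.varFinsetLeft ∧ termCode a = s
  | [1, x, k, m, l] => ∃ as : Fin m → L.Term (ℕ ⊕ Fin k),
      (∀ i, x ∉ (as i).varFinsetLeft) ∧
      Encodable.encode (List.ofFn fun i => termCode (as i)) = l
  | [2, x, k, p] => ∃ φ : L.BoundedFormula ℕ k, x ∉ φ.freeVarFinset ∧ formulaCode φ = p
  | [3, t, k, s, s'] => ∀ b : L.Term ℕ, freeTermCode b = t →
      ∃ a : L.Term (ℕ ⊕ Fin (k + 1)), termCode a = s ∧ termCode (a.subst (instVar b)) = s'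
  | [4, t, k, m, l, l'] => ∀ b : L.Term ℕ, freeTermCode b = t →
      ∃ as : Fin m → L.Term (ℕ ⊕ Fin (k + 1)),
      Encodable.encode (List.ofFn fun i => termCode (as i)) = l ∧
      Encodable.encode (List.ofFn fun i => termCode ((as i).subst (instVar b))) = l'
  | [5, t, k, p, q] => ∀ b : L.Term ℕ, freeTermCode b = t →
      ∃ φ : L.BoundedFormula ℕ (k + 1), formulaCode φ = p ∧ formulaCode (instantiate b φ) = q
  | [6, p] => ∃ φ : L.Formula ℕ, Derivable T φ ∧ formulaCode φ = p
  | _ => False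

theorem encode_listOfFn_succ {m : ℕ} (f : Fin (m + 1) → ℕ) :
    Encodable.encode (List.ofFn f) =
      Nat.pair (f 0) (Encodable.encode (List.ofFn fun i : Fin m => f i.succ)) + 1 := by
  rw [List.ofFn_succ]; rfl

theorem syntaxMeaning_of_freshRule {T : L.Theory} {ps : List (List ℕ)} {c : List ℕ}
    (h : FreshRule L ps c) (ih : ∀ p ∈ ps, SyntaxMeaning T p) : SyntaxMeaning T c := by
  cases h with
  | free x k a h =>
    refine ⟨Term.var (Sum.inl a), ?_, rfl⟩
    simp only [Term.varFinsetLeft, Finset.mem_singleton]; omega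
  | bound x k i h => exact ⟨Term.var (Sum.inr ⟨i, h⟩), by simp [Term.varFinsetLeft], rfl⟩
  | func x k m g l h =>
    obtain ⟨f, rfl⟩ := h
    obtain ⟨as, hx, rfl⟩ := ih _ List.mem_cons_self
    exact ⟨Term.func f as, by simpa [Term.varFinsetLeft] using hx, rfl⟩
  | nil x k => exact ⟨Fin.elim0, fun i => i.elim0, rfl⟩
  | cons x k m s l =>
    obtain ⟨a, hxa, rfl⟩ := ih [0, x, k, s] (by simp)
    obtain ⟨as, hx, rfl⟩ := ih [1, x, k, m, l] (by simp)
    refine ⟨Fin.cons a as, fun i => ?_, ?_⟩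
    · cases i using Fin.cases <;> simp [hxa, hx]
    · rw [encode_listOfFn_succ]; rfl
  | falsum x k => exact ⟨.falsum, by simp [BoundedFormula.freeVarFinset], rfl⟩
  | equal x k s t =>
    obtain ⟨a, hxa, rfl⟩ := ih [0, x, k, s] (by simp)
    obtain ⟨b, hxb, rfl⟩ := ih [0, x, k, t] (by simp)
    exact ⟨.equal a b, by simp [BoundedFormula.freeVarFinset, hxa, hxb], rfl⟩
  | rel x k m g l h =>
    obtain ⟨R, rfl⟩ := h
    obtain ⟨as, hx, rfl⟩ := ih _ List.mem_cons_self
    exact ⟨.rel R as, by simpa [BoundedFormula.freeVarFinset] using hx, rfl⟩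
  | imp x k p q =>
    obtain ⟨φ, hxφ, rfl⟩ := ih [2, x, k, p] (by simp)
    obtain ⟨ψ, hxψ, rfl⟩ := ih [2, x, k, q] (by simp)
    exact ⟨.imp φ ψ, by simp [BoundedFormula.freeVarFinset, hxφ, hxψ], rfl⟩
  | all x k p =>
    obtain ⟨φ, hxφ, rfl⟩ := ih _ List.mem_cons_self
    exact ⟨.all φ, by simpa [BoundedFormula.freeVarFinset] using hxφ, rfl⟩

theorem syntaxMeaning_of_instRule {T : L.Theory} {ps : List (List ℕ)} {c : List ℕ}
    (h : InstRule L ps c) (ih : ∀ p ∈ ps, SyntaxMeaning T p) : SyntaxMeaning T c := by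
  cases h with
  | free t k a => exact fun b _ => ⟨Term.var (Sum.inl a), rfl, rfl⟩
  | zero t k =>
    rintro b rfl
    exact ⟨Term.var (Sum.inr 0), rfl, termCode_relabel_inl b k⟩
  | succ t k i h => exact fun b _ => ⟨Term.var (Sum.inr (Fin.succ ⟨i, h⟩)), rfl, rfl⟩
  | func t k m g l l' h =>
    obtain ⟨f, rfl⟩ := h
    intro b hb
    obtain ⟨as, rfl, rfl⟩ := ih _ List.mem_cons_self b hb
    exact ⟨Term.func f as, rfl, rfl⟩
  | nil t k => exact fun b _ => ⟨Fin.elim0, rfl, rfl⟩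
  | cons t k m s s' l l' =>
    intro b hb
    obtain ⟨a, rfl, rfl⟩ := ih [3, t, k, s, s'] (by simp) b hb
    obtain ⟨as, rfl, rfl⟩ := ih [4, t, k, m, l, l'] (by simp) b hb
    exact ⟨Fin.cons a as, by rw [encode_listOfFn_succ]; rfl, by rw [encode_listOfFn_succ]; rfl⟩
  | falsum t k => exact fun b _ => ⟨.falsum, rfl, by rw [instantiate]; rfl⟩
  | equal t k s s' r r' =>
    intro b hb
    obtain ⟨a₁, rfl, rfl⟩ := ih [3, t, k, s, s'] (by simp) b hb
    obtain ⟨a₂, rfl, rfl⟩ := ih [3, t, k, r, r'] (by simp) b hb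
    exact ⟨.equal a₁ a₂, rfl, by rw [instantiate]; rfl⟩
  | rel t k m g l l' h =>
    obtain ⟨R, rfl⟩ := h
    intro b hb
    obtain ⟨as, rfl, rfl⟩ := ih _ List.mem_cons_self b hb
    exact ⟨.rel R as, rfl, by rw [instantiate]; rfl⟩
  | imp t k p p' q q' =>
    intro b hb
    obtain ⟨φ, rfl, rfl⟩ := ih [5, t, k, p, p'] (by simp) b hb
    obtain ⟨ψ, rfl, rfl⟩ := ih [5, t, k, q, q'] (by simp) b hb
    exact ⟨.imp φ ψ, rfl, by rw [instantiate]; rfl⟩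
  | all t k p p' =>
    intro b hb
    obtain ⟨φ, rfl, rfl⟩ := ih _ List.mem_cons_self b hb
    exact ⟨.all φ, rfl, by rw [instantiate]; rfl⟩

theorem syntaxMeaning_of_derivRule {T : L.Theory} {ps : List (List ℕ)} {c : List ℕ}
    (h : DerivRule T ps c) (ih : ∀ p ∈ ps, SyntaxMeaning T p) : SyntaxMeaning T c := by
  cases h with
  | hyp p h =>
    obtain ⟨σ, hσ, rfl⟩ := h
    exact ⟨_, .hyp hσ, formulaCode_ofSentence σ⟩
  | axK x y p q =>
    obtain ⟨φ, _, rfl⟩ := ih [2, x, 0, p] (by simp)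
    obtain ⟨ψ, _, rfl⟩ := ih [2, y, 0, q] (by simp)
    exact ⟨_, .axK φ ψ, rfl⟩
  | axS x y z p q r =>
    obtain ⟨φ, _, rfl⟩ := ih [2, x, 0, p] (by simp)
    obtain ⟨ψ, _, rfl⟩ := ih [2, y, 0, q] (by simp)
    obtain ⟨χ, _, rfl⟩ := ih [2, z, 0, r] (by simp)
    exact ⟨_, .axS φ ψ χ, rfl⟩
  | axDN x p =>
    obtain ⟨φ, _, rfl⟩ := ih [2, x, 0, p] (by simp)
    exact ⟨_, .axDN φ, rfl⟩
  | mp p q =>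
    obtain ⟨χ, hχ, hcode⟩ := ih [6, Nat.pair 3 (Nat.pair p q)] (by simp)
    obtain ⟨φ, hφ, rfl⟩ := ih [6, p] (by simp)
    cases χ <;> simp only [formulaCode, Nat.pair_eq_pair] at hcode <;> try omega
    rename_i φ' ψ
    obtain rfl := formulaCode_injective hcode.2.1
    exact ⟨ψ, .mp hχ hφ, hcode.2.2⟩
  | axInst x t p q =>
    obtain ⟨a, _, ha⟩ := ih [0, x, 0, t] (by simp)
    obtain ⟨b, hb⟩ := exists_freeTermCode a
    obtain ⟨φ, rfl, rfl⟩ := ih [5, t, 0, p, q] (by simp) b (hb.trans ha)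
    exact ⟨_, .axInst φ b, rfl⟩
  | gen x r p q =>
    obtain ⟨ψ, hxψ, rfl⟩ := ih [2, x, 0, r] (by simp)
    obtain ⟨φ, hxφ, rfl⟩ := ih [2, x, 1, p] (by simp)
    obtain ⟨φ', hφ', rfl⟩ :=
      ih [5, Nat.pair 0 (2 * x), 0, formulaCode φ, q] (by simp) (Term.var x) (freeTermCode_var x)
    obtain rfl := formulaCode_injective hφ'
    obtain ⟨χ, hχ, hcode⟩ := ih [6, _] (List.mem_cons_of_mem _ (List.mem_cons_of_mem _
      (List.mem_cons_of_mem _ List.mem_cons_self)))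
    obtain rfl : χ = ψ.imp (instantiate (Term.var x) φ') := formulaCode_injective hcode
    exact ⟨_, .gen hxψ hxφ hχ, rfl⟩
  | axRefl x t =>
    obtain ⟨a, _, ha⟩ := ih [0, x, 0, t] (by simp)
    obtain ⟨b, hb⟩ := exists_freeTermCode a
    exact ⟨_, .axRefl b, by rw [formulaCode_equal, hb, ha]⟩
  | axLeibniz x y s t p q q' =>
    obtain ⟨a₁, _, ha₁⟩ := ih [0, x, 0, s] (by simp)
    obtain ⟨b₁, hb₁⟩ := exists_freeTermCode a₁
    obtain ⟨a₂, _, ha₂⟩ := ih [0, y, 0, t] (by simp)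
    obtain ⟨b₂, hb₂⟩ := exists_freeTermCode a₂
    obtain ⟨φ, rfl, rfl⟩ := ih [5, s, 0, p, q] (by simp) b₁ (hb₁.trans ha₁)
    obtain ⟨φ', hφ', rfl⟩ := ih [5, t, 0, formulaCode φ, q'] (by simp) b₂ (hb₂.trans ha₂)
    obtain rfl := formulaCode_injective hφ'
    refine ⟨_, .axLeibniz b₁ b₂ φ', ?_⟩
    rw [← ha₁, ← ha₂, ← hb₁, ← hb₂]
    rfl

theorem syntaxMeaning_of_closure {T : L.Theory} {c : List ℕ} (h : Closure (SyntaxRule T) c) :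
    SyntaxMeaning T c := by
  induction h with
  | intro h _ ih =>
    rcases h with h | h | h
    exacts [syntaxMeaning_of_freshRule h ih, syntaxMeaning_of_instRule h ih,
      syntaxMeaning_of_derivRule h ih]

section Completeness

variable {T : L.Theory}

theorem closure_of_freshRule {ps : List (List ℕ)} {c : List ℕ} (h : FreshRule L ps c)
    (hps : ∀ p ∈ ps, Closure (SyntaxRule T) p) : Closure (SyntaxRule T) c :=
  .intro (Or.inl h) hps

theorem closure_of_instRule {ps : List (List ℕ)} {c : List ℕ} (h : InstRule L ps c)
    (hps : ∀ p ∈ ps, Closure (SyntaxRule T) p) : Closure (SyntaxRule T) c :=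
  .intro (Or.inr (Or.inl h)) hps

theorem closure_of_derivRule {ps : List (List ℕ)} {c : List ℕ} (h : DerivRule T ps c)
    (hps : ∀ p ∈ ps, Closure (SyntaxRule T) p) : Closure (SyntaxRule T) c :=
  .intro (Or.inr (Or.inr h)) hps

theorem closure_args {x k : ℕ} : ∀ {m : ℕ} (as : Fin m → ℕ),
    (∀ i, Closure (SyntaxRule T) [0, x, k, as i]) →
      Closure (SyntaxRule T) [1, x, k, m, Encodable.encode (List.ofFn as)] := by
  intro m
  induction m with
  | zero => intro as _; exact closure_of_freshRule (.nil x k) (by simp)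
  | succ m ih =>
    intro as h
    rw [encode_listOfFn_succ]
    exact closure_of_freshRule (.cons x k m _ _)
      (by simpa using ⟨h 0, ih (fun i => as i.succ) fun i => h i.succ⟩)

theorem closure_instArgs {t k : ℕ} : ∀ {m : ℕ} (as bs : Fin m → ℕ),
    (∀ i, Closure (SyntaxRule T) [3, t, k, as i, bs i]) →
      Closure (SyntaxRule T)
        [4, t, k, m, Encodable.encode (List.ofFn as), Encodable.encode (List.ofFn bs)] := by
  intro m
  induction m with
  | zero => intro as bs _; exact closure_of_instRule (.nil t k) (by simp)
  | succ m ih =>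
    intro as bs h
    rw [encode_listOfFn_succ, encode_listOfFn_succ]
    exact closure_of_instRule (.cons t k m _ _ _ _)
      (by simpa using ⟨h 0, ih (fun i => as i.succ) (fun i => bs i.succ) fun i => h i.succ⟩)

theorem closure_term {x k : ℕ} (a : L.Term (ℕ ⊕ Fin k)) (hx : x ∉ a.varFinsetLeft) :
    Closure (SyntaxRule T) [0, x, k, termCode a] := by
  induction a with
  | var b =>
    rcases b with b | i
    · simp only [Term.varFinsetLeft, Finset.mem_singleton] at hx
      exact closure_of_freshRule (.free x k b (lt_or_gt_of_ne hx)) (by simp)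
    · exact closure_of_freshRule (.bound x k i i.isLt) (by simp)
  | @func m f as ih =>
    simp only [Term.varFinsetLeft, Finset.mem_biUnion, Finset.mem_univ, true_and,
      not_exists] at hx
    exact closure_of_freshRule (.func x k m _ _ ⟨f, rfl⟩)
      (by simpa using closure_args _ fun i => ih i (hx i))

theorem closure_formula {x k : ℕ} (φ : L.BoundedFormula ℕ k) (hx : x ∉ φ.freeVarFinset) :
    Closure (SyntaxRule T) [2, x, k, formulaCode φ] := by
  induction φ with
  | falsum => exact closure_of_freshRule (.falsum x _) (by simp)
  | equal s t =>
    simp only [BoundedFormula.freeVarFinset, Finset.mem_union, not_or] at hx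
    exact closure_of_freshRule (.equal x _ _ _)
      (by simpa using ⟨closure_term s hx.1, closure_term t hx.2⟩)
  | rel R as =>
    simp only [BoundedFormula.freeVarFinset, Finset.mem_biUnion, Finset.mem_univ, true_and,
      not_exists] at hx
    exact closure_of_freshRule (.rel x _ _ _ _ ⟨R, rfl⟩)
      (by simpa using closure_args _ fun i => closure_term (as i) (hx i))
  | imp φ ψ ih₁ ih₂ =>
    simp only [BoundedFormula.freeVarFinset, Finset.mem_union, not_or] at hx
    exact closure_of_freshRule (.imp x _ _ _) (by simpa using ⟨ih₁ hx.1, ih₂ hx.2⟩)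
  | all φ ih => exact closure_of_freshRule (.all x _ _) (by simpa using ih hx)

theorem exists_closure_formula {k : ℕ} (φ : L.BoundedFormula ℕ k) :
    ∃ x, Closure (SyntaxRule T) [2, x, k, formulaCode φ] := by
  obtain ⟨x, hx⟩ := Infinite.exists_notMem_finset φ.freeVarFinset
  exact ⟨x, closure_formula φ hx⟩

theorem exists_closure_freeTermCode (t : L.Term ℕ) :
    ∃ x, Closure (SyntaxRule T) [0, x, 0, freeTermCode t] := by
  obtain ⟨x, hx⟩ := Infinite.exists_notMem_finset
    (t.relabel (Sum.inl : ℕ → ℕ ⊕ Fin 0)).varFinsetLeft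
  exact ⟨x, closure_term _ hx⟩

theorem closure_instTerm (t : L.Term ℕ) {k : ℕ} (a : L.Term (ℕ ⊕ Fin (k + 1))) :
    Closure (SyntaxRule T)
      [3, freeTermCode t, k, termCode a, termCode (a.subst (instVar t))] := by
  induction a with
  | var b =>
    rcases b with b | i
    · exact closure_of_instRule (.free _ k b) (by simp)
    · cases i using Fin.cases with
      | zero =>
        have h : termCode ((Term.var (Sum.inr 0) : L.Term (ℕ ⊕ Fin (k + 1))).subst (instVar t)) =
            freeTermCode t := termCode_relabel_inl t k
        rw [h]
        exact closure_of_instRule (.zero _ k) (by simp)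
      | succ i => exact closure_of_instRule (.succ _ k i i.isLt) (by simp)
  | @func m f as ih =>
    exact closure_of_instRule (.func _ k m _ _ _ ⟨f, rfl⟩)
      (by simpa using closure_instArgs _ _ ih)

theorem closure_instantiate (t : L.Term ℕ) : ∀ {k : ℕ} (φ : L.BoundedFormula ℕ (k + 1)),
    Closure (SyntaxRule T)
      [5, freeTermCode t, k, formulaCode φ, formulaCode (instantiate t φ)]
  | _, .falsum => by
    rw [instantiate]
    exact closure_of_instRule (.falsum _ _) (by simp)
  | _, .equal s₁ s₂ => by
    rw [instantiate]
    exact closure_of_instRule (.equal _ _ _ _ _ _)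
      (by simpa using ⟨closure_instTerm t s₁, closure_instTerm t s₂⟩)
  | _, .rel R as => by
    rw [instantiate]
    exact closure_of_instRule (.rel _ _ _ _ _ _ ⟨R, rfl⟩)
      (by simpa using closure_instArgs _ _ fun i => closure_instTerm t (as i))
  | _, .imp φ ψ => by
    rw [instantiate]
    exact closure_of_instRule (.imp _ _ _ _ _ _)
      (by simpa using ⟨closure_instantiate t φ, closure_instantiate t ψ⟩)
  | _, .all φ => by
    rw [instantiate]
    exact closure_of_instRule (.all _ _ _ _) (by simpa using closure_instantiate t φ)

theorem closure_derivable {φ : L.Formula ℕ} (h : Derivable T φ) :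
    Closure (SyntaxRule T) [6, formulaCode φ] := by
  induction h with
  | @hyp σ h =>
    rw [formulaCode_ofSentence]
    exact closure_of_derivRule (.hyp _ ⟨σ, h, rfl⟩) (by simp)
  | axK φ ψ =>
    obtain ⟨x, hx⟩ := exists_closure_formula (T := T) φ
    obtain ⟨y, hy⟩ := exists_closure_formula (T := T) ψ
    exact closure_of_derivRule (.axK x y _ _) (by simpa using ⟨hx, hy⟩)
  | axS φ ψ χ =>
    obtain ⟨x, hx⟩ := exists_closure_formula (T := T) φ
    obtain ⟨y, hy⟩ := exists_closure_formula (T := T) ψ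
    obtain ⟨z, hz⟩ := exists_closure_formula (T := T) χ
    exact closure_of_derivRule (.axS x y z _ _ _) (by simpa using ⟨hx, hy, hz⟩)
  | axDN φ =>
    obtain ⟨x, hx⟩ := exists_closure_formula (T := T) φ
    exact closure_of_derivRule (.axDN x _) (by simpa using hx)
  | mp _ _ ih₁ ih₂ => exact closure_of_derivRule (.mp _ _) (by simpa using ⟨ih₁, ih₂⟩)
  | axInst φ t =>
    obtain ⟨x, hx⟩ := exists_closure_freeTermCode (T := T) t
    exact closure_of_derivRule (.axInst x _ _ _) (by simpa using ⟨hx, closure_instantiate t φ⟩)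
  | @gen ψ φ x hψ hφ _ ih =>
    exact closure_of_derivRule (.gen x _ _ _)
      (by simpa using ⟨closure_formula ψ hψ, closure_formula φ hφ,
        closure_instantiate (Term.var x) φ, ih⟩)
  | axRefl t =>
    obtain ⟨x, hx⟩ := exists_closure_freeTermCode (T := T) t
    exact closure_of_derivRule (.axRefl x (freeTermCode t)) (by simpa using hx)
  | axLeibniz s t φ =>
    obtain ⟨x, hx⟩ := exists_closure_freeTermCode (T := T) s
    obtain ⟨y, hy⟩ := exists_closure_freeTermCode (T := T) t
    exact closure_of_derivRule (.axLeibniz x y _ _ _ _ _)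
      (by simpa using ⟨hx, hy, closure_instantiate s φ, closure_instantiate t φ⟩)

end Completeness

/-- The theorems of an RE theory form an RE set. The predicate below may hold of numbers that are
not numbers of sentences. -/
theorem exists_rePred_iff_proves [Finite (Σ n, L.Functions n)] [Finite (Σ n, L.Relations n)]
    {T : L.Theory} (hT : IsRE T) :
    ∃ D : ℕ → Prop, REPred D ∧ ∀ φ : L.Sentence, D (sentenceCode φ) ↔ Proves T φ := by
  refine ⟨fun n => Closure (SyntaxRule T) [6, n],
    (rePred_closure_syntaxRule hT).preimage (by fun_prop), fun φ => ⟨fun h => ?_, fun h => ?_⟩⟩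
  · obtain ⟨ψ, hψ, hcode⟩ := syntaxMeaning_of_closure h
    rw [← formulaCode_ofSentence] at hcode
    rwa [formulaCode_injective hcode] at hψ
  · rw [← formulaCode_ofSentence]
    exact closure_derivable h

end Adequacy

/-! ### Truth of pure `Σ⁰₁`-sentences is recursively enumerable -/

section Truth

open PureDelta

/-- The truth value of `a < b`, as `0` or `1`. -/
def ltBit (a b : ℕ) : ℕ := 1 - (1 - (b - a))

/-- The truth value of `a = b`, as `0` or `1`. -/
def eqBit (a b : ℕ) : ℕ := 1 - ((a - b) + (b - a))

@[fun_prop]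
theorem computable_ltBit {α : Type*} [Primcodable α] {f g : α → ℕ} (hf : Computable f)
    (hg : Computable g) : Computable fun a => ltBit (f a) (g a) := by
  unfold ltBit; fun_prop

@[fun_prop]
theorem computable_eqBit {α : Type*} [Primcodable α] {f g : α → ℕ} (hf : Computable f)
    (hg : Computable g) : Computable fun a => eqBit (f a) (g a) := by
  unfold eqBit; fun_prop

open Classical in
/-- The truth value of a proposition, as `0` or `1`. -/
noncomputable def bit (p : Prop) : ℕ := if p then 1 else 0

theorem bit_eq_one_iff {p : Prop} : bit p = 1 ↔ p := by
  unfold bit; split <;> simp_all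

theorem bit_true {p : Prop} (h : p) : bit p = 1 := if_pos h

theorem bit_false {p : Prop} (h : ¬ p) : bit p = 0 := if_neg h

theorem ltBit_eq (a b : ℕ) : ltBit a b = bit (a < b) := by
  unfold ltBit bit; split <;> omega

theorem eqBit_eq (a b : ℕ) : eqBit a b = bit (a = b) := by
  unfold eqBit bit; split <;> omega

theorem bit_not (p : Prop) : bit (¬ p) = 1 - bit p := by
  by_cases h : p <;> simp [bit, h]

theorem bit_and (p q : Prop) : bit (p ∧ q) = bit p * bit q := by
  by_cases h : p <;> by_cases h' : q <;> simp [bit, h, h']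

theorem bit_or (p q : Prop) : bit (p ∨ q) = 1 - (1 - bit p) * (1 - bit q) := by
  by_cases h : p <;> by_cases h' : q <;> simp [bit, h, h']

theorem bit_imp (p q : Prop) : bit (p → q) = 1 - bit p * (1 - bit q) := by
  by_cases h : p <;> by_cases h' : q <;> simp [bit, h, h']

theorem PureDelta.code_injective : Function.Injective PureDelta.code := by
  intro δ
  induction δ with
  | neg δ ih =>
    intro ε h
    cases ε <;> simp only [PureDelta.code, Nat.pair_eq_pair] at h <;> try omega
    rw [ih h.2]
  | and δ₁ δ₂ ih₁ ih₂ | or δ₁ δ₂ ih₁ ih₂ | imp δ₁ δ₂ ih₁ ih₂ =>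
    intro ε h
    cases ε <;> simp only [PureDelta.code, Nat.pair_eq_pair] at h <;> try omega
    rw [ih₁ h.2.1, ih₂ h.2.2]
  | allLT v δ ih | exLT v δ ih | allLE v δ ih | exLE v δ ih =>
    intro ε h
    cases ε <;> simp only [PureDelta.code, Nat.pair_eq_pair] at h <;> try omega
    rw [h.2.1, ih h.2.2]
  | _ =>
    intro ε h
    cases ε <;> simp only [PureDelta.code, Nat.pair_eq_pair] at h <;> first | omega | simp_all

theorem PureSigma.code_injective : Function.Injective PureSigma.code := by
  rintro ⟨δ, _⟩ ⟨ε, _⟩ h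
  obtain rfl : δ = ε := PureDelta.code_injective h
  rfl

/-- The assignment that a list of values describes; the variables beyond its length get the
value `0`. -/
def listEnv (e : List ℕ) : ℕ → ℕ := fun i => e.getD i 0

theorem listEnv_cons (a : ℕ) (e : List ℕ) : listEnv (a :: e) = push a (listEnv e) := by
  funext i; cases i <;> simp [listEnv, push]

theorem listEnv_of_getElem? {e : List ℕ} {u a : ℕ} (h : e[u]? = some a) :
    u < e.length ∧ listEnv e u = a := by
  obtain ⟨hu, rfl⟩ := List.getElem?_eq_some_iff.1 h
  exact ⟨hu, by simp [listEnv, hu]⟩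

theorem getElem?_eq_listEnv {e : List ℕ} {u : ℕ} (h : u < e.length) :
    e[u]? = some (listEnv e u) := by
  simp [listEnv, h]

/-- Rules that evaluate atomic pure `Δ₀`-formulas: `0 :: d :: b :: e` says that `d` is the number of
a formula whose free variables get values from the list `e` and that `b` is its truth value. -/
inductive AtomRule : List (List ℕ) → List ℕ → Prop
  | bot (e : List ℕ) : AtomRule [] (0 :: Nat.pair 0 0 :: 0 :: e)
  | top (e : List ℕ) : AtomRule [] (0 :: Nat.pair 1 0 :: 1 :: e)
  | lt (e : List ℕ) (u v a b : ℕ) : e[u]? = some a → e[v]? = some b →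
      AtomRule [] (0 :: Nat.pair 2 (Nat.pair u v) :: ltBit a b :: e)
  | zero (e : List ℕ) (u a : ℕ) : e[u]? = some a →
      AtomRule [] (0 :: Nat.pair 3 u :: eqBit 0 a :: e)
  | succ (e : List ℕ) (u v a b : ℕ) : e[u]? = some a → e[v]? = some b →
      AtomRule [] (0 :: Nat.pair 4 (Nat.pair u v) :: eqBit (a + 1) b :: e)
  | add (e : List ℕ) (u v w a b c : ℕ) : e[u]? = some a → e[v]? = some b → e[w]? = some c →
      AtomRule [] (0 :: Nat.pair 5 (Nat.pair u (Nat.pair v w)) :: eqBit (a + b) c :: e)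
  | mul (e : List ℕ) (u v w a b c : ℕ) : e[u]? = some a → e[v]? = some b → e[w]? = some c →
      AtomRule [] (0 :: Nat.pair 6 (Nat.pair u (Nat.pair v w)) :: eqBit (a * b) c :: e)

/-- Rules that evaluate compound pure `Δ₀`-formulas. The statement `1 :: m :: d :: s :: e` says that
the formula number `d` holds of exactly `s` of the values `a < m` of the variable `0`, where `e`
gives the values of the other variables. The premise of `countZero` only serves to say that `d` is
the number of a formula with variables in the right range. -/
inductive CompoundRule : List (List ℕ) → List ℕ → Prop
  | neg (e : List ℕ) (d b : ℕ) :
      CompoundRule [0 :: d :: b :: e] (0 :: Nat.pair 7 d :: (1 - b) :: e)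
  | and (e : List ℕ) (d b d' b' : ℕ) :
      CompoundRule [0 :: d :: b :: e, 0 :: d' :: b' :: e]
        (0 :: Nat.pair 8 (Nat.pair d d') :: (b * b') :: e)
  | or (e : List ℕ) (d b d' b' : ℕ) :
      CompoundRule [0 :: d :: b :: e, 0 :: d' :: b' :: e]
        (0 :: Nat.pair 9 (Nat.pair d d') :: (1 - (1 - b) * (1 - b')) :: e)
  | imp (e : List ℕ) (d b d' b' : ℕ) :
      CompoundRule [0 :: d :: b :: e, 0 :: d' :: b' :: e]
        (0 :: Nat.pair 10 (Nat.pair d d') :: (1 - b * (1 - b')) :: e)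
  | allLT (e : List ℕ) (v m d s : ℕ) : e[v]? = some m →
      CompoundRule [1 :: m :: d :: s :: e] (0 :: Nat.pair 11 (Nat.pair v d) :: eqBit s m :: e)
  | exLT (e : List ℕ) (v m d s : ℕ) : e[v]? = some m →
      CompoundRule [1 :: m :: d :: s :: e] (0 :: Nat.pair 12 (Nat.pair v d) :: ltBit 0 s :: e)
  | allLE (e : List ℕ) (v m d s : ℕ) : e[v]? = some m →
      CompoundRule [1 :: (m + 1) :: d :: s :: e]
        (0 :: Nat.pair 13 (Nat.pair v d) :: eqBit s (m + 1) :: e)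
  | exLE (e : List ℕ) (v m d s : ℕ) : e[v]? = some m →
      CompoundRule [1 :: (m + 1) :: d :: s :: e]
        (0 :: Nat.pair 14 (Nat.pair v d) :: ltBit 0 s :: e)
  | countZero (e : List ℕ) (d b : ℕ) :
      CompoundRule [0 :: d :: b :: 0 :: e] (1 :: 0 :: d :: 0 :: e)
  | countSucc (e : List ℕ) (m d s b : ℕ) :
      CompoundRule [1 :: m :: d :: s :: e, 0 :: d :: b :: m :: e]
        (1 :: (m + 1) :: d :: (s + b) :: e)

/-- All rules for the evaluation of pure `Δ₀`-formulas. -/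
def TruthRule (ps : List (List ℕ)) (c : List ℕ) : Prop := AtomRule ps c ∨ CompoundRule ps c

theorem rePred_atomRule : REPred fun x : List (List ℕ) × List ℕ => AtomRule x.1 x.2 := by
  -- one disjunct for each rule
  have h : REPred fun y : List (List ℕ) × List ℕ =>
      (∃ e, y.1 = [] ∧ y.2 = 0 :: Nat.pair 0 0 :: 0 :: e) ∨
      (∃ e, y.1 = [] ∧ y.2 = 0 :: Nat.pair 1 0 :: 1 :: e) ∨
      (∃ (e : List ℕ) (u v a b : ℕ), e[u]? = some a ∧ e[v]? = some b ∧ y.1 = [] ∧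
        y.2 = 0 :: Nat.pair 2 (Nat.pair u v) :: ltBit a b :: e) ∨
      (∃ (e : List ℕ) (u a : ℕ), e[u]? = some a ∧ y.1 = [] ∧
        y.2 = 0 :: Nat.pair 3 u :: eqBit 0 a :: e) ∨
      (∃ (e : List ℕ) (u v a b : ℕ), e[u]? = some a ∧ e[v]? = some b ∧ y.1 = [] ∧
        y.2 = 0 :: Nat.pair 4 (Nat.pair u v) :: eqBit (a + 1) b :: e) ∨
      (∃ (e : List ℕ) (u v w a b c : ℕ), e[u]? = some a ∧ e[v]? = some b ∧ e[w]? = some c ∧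
        y.1 = [] ∧ y.2 = 0 :: Nat.pair 5 (Nat.pair u (Nat.pair v w)) :: eqBit (a + b) c :: e) ∨
      (∃ (e : List ℕ) (u v w a b c : ℕ), e[u]? = some a ∧ e[v]? = some b ∧ e[w]? = some c ∧
        y.1 = [] ∧ y.2 = 0 :: Nat.pair 6 (Nat.pair u (Nat.pair v w)) :: eqBit (a * b) c :: e) := by
    repeat' first
      | apply REPred.or | apply REPred.exists | apply REPred.and | apply rePred_eq
    all_goals fun_prop
  refine h.of_eq fun ⟨ps, c⟩ => ⟨fun h => ?_, fun h => ?_⟩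
  · simp only at h
    rcases h with ⟨e, rfl, rfl⟩ | ⟨e, rfl, rfl⟩ | ⟨e, u, v, a, b, hu, hv, rfl, rfl⟩ |
      ⟨e, u, a, hu, rfl, rfl⟩ | ⟨e, u, v, a, b, hu, hv, rfl, rfl⟩ |
      ⟨e, u, v, w, a, b, c, hu, hv, hw, rfl, rfl⟩ | ⟨e, u, v, w, a, b, c, hu, hv, hw, rfl, rfl⟩
    exacts [.bot e, .top e, .lt e u v a b hu hv, .zero e u a hu, .succ e u v a b hu hv,
      .add e u v w a b c hu hv hw, .mul e u v w a b c hu hv hw]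
  · cases h with
    | bot e => exact Or.inl ⟨e, rfl, rfl⟩
    | top e => exact Or.inr (Or.inl ⟨e, rfl, rfl⟩)
    | lt e u v a b hu hv => exact Or.inr (Or.inr (Or.inl ⟨e, u, v, a, b, hu, hv, rfl, rfl⟩))
    | zero e u a hu => exact Or.inr (Or.inr (Or.inr (Or.inl ⟨e, u, a, hu, rfl, rfl⟩)))
    | succ e u v a b hu hv =>
      exact Or.inr (Or.inr (Or.inr (Or.inr (Or.inl ⟨e, u, v, a, b, hu, hv, rfl, rfl⟩))))
    | add e u v w a b c hu hv hw =>
      exact Or.inr (Or.inr (Or.inr (Or.inr (Or.inr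
        (Or.inl ⟨e, u, v, w, a, b, c, hu, hv, hw, rfl, rfl⟩)))))
    | mul e u v w a b c hu hv hw =>
      exact Or.inr (Or.inr (Or.inr (Or.inr (Or.inr
        (Or.inr ⟨e, u, v, w, a, b, c, hu, hv, hw, rfl, rfl⟩)))))

theorem rePred_compoundRule : REPred fun x : List (List ℕ) × List ℕ => CompoundRule x.1 x.2 := by
  -- one disjunct for each rule
  have h : REPred fun y : List (List ℕ) × List ℕ =>
      (∃ (e : List ℕ) (v m d s : ℕ), e[v]? = some m ∧ y.1 = [1 :: m :: d :: s :: e] ∧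
        y.2 = 0 :: Nat.pair 11 (Nat.pair v d) :: eqBit s m :: e) ∨
      (∃ (e : List ℕ) (v m d s : ℕ), e[v]? = some m ∧ y.1 = [1 :: m :: d :: s :: e] ∧
        y.2 = 0 :: Nat.pair 12 (Nat.pair v d) :: ltBit 0 s :: e) ∨
      (∃ (e : List ℕ) (v m d s : ℕ), e[v]? = some m ∧ y.1 = [1 :: (m + 1) :: d :: s :: e] ∧
        y.2 = 0 :: Nat.pair 13 (Nat.pair v d) :: eqBit s (m + 1) :: e) ∨
      (∃ (e : List ℕ) (v m d s : ℕ), e[v]? = some m ∧ y.1 = [1 :: (m + 1) :: d :: s :: e] ∧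
        y.2 = 0 :: Nat.pair 14 (Nat.pair v d) :: ltBit 0 s :: e) ∨
      (∃ e d b, y.1 = [0 :: d :: b :: e] ∧ y.2 = 0 :: Nat.pair 7 d :: (1 - b) :: e) ∨
      (∃ e d b d' b', y.1 = [0 :: d :: b :: e, 0 :: d' :: b' :: e] ∧
        y.2 = 0 :: Nat.pair 8 (Nat.pair d d') :: (b * b') :: e) ∨
      (∃ e d b d' b', y.1 = [0 :: d :: b :: e, 0 :: d' :: b' :: e] ∧
        y.2 = 0 :: Nat.pair 9 (Nat.pair d d') :: (1 - (1 - b) * (1 - b')) :: e) ∨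
      (∃ e d b d' b', y.1 = [0 :: d :: b :: e, 0 :: d' :: b' :: e] ∧
        y.2 = 0 :: Nat.pair 10 (Nat.pair d d') :: (1 - b * (1 - b')) :: e) ∨
      (∃ e d b, y.1 = [0 :: d :: b :: 0 :: e] ∧ y.2 = 1 :: 0 :: d :: 0 :: e) ∨
      (∃ e m d s b, y.1 = [1 :: m :: d :: s :: e, 0 :: d :: b :: m :: e] ∧
        y.2 = 1 :: (m + 1) :: d :: (s + b) :: e) := by
    repeat' first
      | apply REPred.or | apply REPred.exists | apply REPred.and | apply rePred_eq
    all_goals fun_prop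
  refine h.of_eq fun ⟨ps, c⟩ => ⟨fun h => ?_, fun h => ?_⟩
  · simp only at h
    rcases h with ⟨e, v, m, d, s, h, rfl, rfl⟩ | ⟨e, v, m, d, s, h, rfl, rfl⟩ |
      ⟨e, v, m, d, s, h, rfl, rfl⟩ | ⟨e, v, m, d, s, h, rfl, rfl⟩ |
      ⟨e, d, b, rfl, rfl⟩ | ⟨e, d, b, d', b', rfl, rfl⟩ | ⟨e, d, b, d', b', rfl, rfl⟩ |
      ⟨e, d, b, d', b', rfl, rfl⟩ | ⟨e, d, b, rfl, rfl⟩ | ⟨e, m, d, s, b, rfl, rfl⟩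
    exacts [.allLT e v m d s h, .exLT e v m d s h, .allLE e v m d s h, .exLE e v m d s h,
      .neg e d b, .and e d b d' b', .or e d b d' b', .imp e d b d' b', .countZero e d b,
      .countSucc e m d s b]
  · cases h with
    | allLT e v m d s h => exact Or.inl ⟨e, v, m, d, s, h, rfl, rfl⟩
    | exLT e v m d s h => exact Or.inr (Or.inl ⟨e, v, m, d, s, h, rfl, rfl⟩)
    | allLE e v m d s h => exact Or.inr (Or.inr (Or.inl ⟨e, v, m, d, s, h, rfl, rfl⟩))
    | exLE e v m d s h => exact Or.inr (Or.inr (Or.inr (Or.inl ⟨e, v, m, d, s, h, rfl, rfl⟩)))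
    | _ => simp

theorem rePred_closure_truthRule : REPred (Closure TruthRule) :=
  rePred_closure (rePred_atomRule.or rePred_compoundRule)

open Classical in
/-- The intended meaning of the statements that the rules of `TruthRule` derive. -/
def TruthMeaning : List ℕ → Prop
  | 0 :: d :: b :: e => ∃ δ : PureDelta, δ.code = d ∧ δ.Scoped e.length ∧
      b = bit (δ.Holds (listEnv e))
  | 1 :: m :: d :: s :: e => ∃ δ : PureDelta, δ.code = d ∧ δ.Scoped (e.length + 1) ∧
      s = Nat.count (fun a => δ.Holds (push a (listEnv e))) m
  | _ => False

theorem bit_eq_bit {p q : Prop} (h : p ↔ q) : bit p = bit q := by rw [propext h]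

open Classical in
theorem eqBit_count (p : ℕ → Prop) (m : ℕ) : eqBit (Nat.count p m) m = bit (∀ a, a < m → p a) := by
  rw [eqBit_eq]; exact bit_eq_bit Nat.count_iff_forall

open Classical in
theorem ltBit_count (p : ℕ → Prop) (m : ℕ) : ltBit 0 (Nat.count p m) = bit (∃ a, a < m ∧ p a) := by
  rw [ltBit_eq, Nat.pos_iff_ne_zero]; exact bit_eq_bit Nat.count_ne_iff_exists

theorem truthMeaning_of_atomRule {ps : List (List ℕ)} {c : List ℕ} (h : AtomRule ps c) :
    TruthMeaning c := by
  cases h with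
  | bot e => exact ⟨.bot, rfl, trivial, (bit_false id).symm⟩
  | top e => exact ⟨.top, rfl, trivial, (bit_true trivial).symm⟩
  | lt e u v a b hu hv =>
    obtain ⟨hu', rfl⟩ := listEnv_of_getElem? hu
    obtain ⟨hv', rfl⟩ := listEnv_of_getElem? hv
    exact ⟨.lt u v, rfl, ⟨hu', hv'⟩, ltBit_eq _ _⟩
  | zero e u a hu =>
    obtain ⟨hu', rfl⟩ := listEnv_of_getElem? hu
    exact ⟨.zero u, rfl, hu', eqBit_eq _ _⟩
  | succ e u v a b hu hv =>
    obtain ⟨hu', rfl⟩ := listEnv_of_getElem? hu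
    obtain ⟨hv', rfl⟩ := listEnv_of_getElem? hv
    exact ⟨.succ u v, rfl, ⟨hu', hv'⟩, eqBit_eq _ _⟩
  | add e u v w a b c hu hv hw =>
    obtain ⟨hu', rfl⟩ := listEnv_of_getElem? hu
    obtain ⟨hv', rfl⟩ := listEnv_of_getElem? hv
    obtain ⟨hw', rfl⟩ := listEnv_of_getElem? hw
    exact ⟨.add u v w, rfl, ⟨hu', hv', hw'⟩, eqBit_eq _ _⟩
  | mul e u v w a b c hu hv hw =>
    obtain ⟨hu', rfl⟩ := listEnv_of_getElem? hu
    obtain ⟨hv', rfl⟩ := listEnv_of_getElem? hv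
    obtain ⟨hw', rfl⟩ := listEnv_of_getElem? hw
    exact ⟨.mul u v w, rfl, ⟨hu', hv', hw'⟩, eqBit_eq _ _⟩

theorem truthMeaning_of_compoundRule {ps : List (List ℕ)} {c : List ℕ} (h : CompoundRule ps c)
    (ih : ∀ p ∈ ps, TruthMeaning p) : TruthMeaning c := by
  classical
  cases h with
  | neg e d b =>
    obtain ⟨δ, rfl, hs, rfl⟩ := ih _ List.mem_cons_self
    exact ⟨.neg δ, rfl, hs, (bit_not _).symm⟩
  | and e d b d' b' =>
    obtain ⟨δ, rfl, hs, rfl⟩ := ih (0 :: d :: b :: e) (by simp)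
    obtain ⟨ε, rfl, hs', rfl⟩ := ih (0 :: d' :: b' :: e) (by simp)
    exact ⟨.and δ ε, rfl, ⟨hs, hs'⟩, (bit_and _ _).symm⟩
  | or e d b d' b' =>
    obtain ⟨δ, rfl, hs, rfl⟩ := ih (0 :: d :: b :: e) (by simp)
    obtain ⟨ε, rfl, hs', rfl⟩ := ih (0 :: d' :: b' :: e) (by simp)
    exact ⟨.or δ ε, rfl, ⟨hs, hs'⟩, (bit_or _ _).symm⟩
  | imp e d b d' b' =>
    obtain ⟨δ, rfl, hs, rfl⟩ := ih (0 :: d :: b :: e) (by simp)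
    obtain ⟨ε, rfl, hs', rfl⟩ := ih (0 :: d' :: b' :: e) (by simp)
    exact ⟨.imp δ ε, rfl, ⟨hs, hs'⟩, (bit_imp _ _).symm⟩
  | allLT e v m d s h =>
    obtain ⟨δ, rfl, hs, rfl⟩ := ih _ List.mem_cons_self
    obtain ⟨hv, rfl⟩ := listEnv_of_getElem? h
    exact ⟨.allLT v δ, rfl, ⟨hv, hs⟩, eqBit_count _ _⟩
  | exLT e v m d s h =>
    obtain ⟨δ, rfl, hs, rfl⟩ := ih _ List.mem_cons_self
    obtain ⟨hv, rfl⟩ := listEnv_of_getElem? h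
    exact ⟨.exLT v δ, rfl, ⟨hv, hs⟩, ltBit_count _ _⟩
  | allLE e v m d s h =>
    obtain ⟨δ, rfl, hs, rfl⟩ := ih _ List.mem_cons_self
    obtain ⟨hv, rfl⟩ := listEnv_of_getElem? h
    refine ⟨.allLE v δ, rfl, ⟨hv, hs⟩, (eqBit_count _ _).trans (bit_eq_bit ?_)⟩
    simp only [Nat.lt_succ_iff, Holds]
  | exLE e v m d s h =>
    obtain ⟨δ, rfl, hs, rfl⟩ := ih _ List.mem_cons_self
    obtain ⟨hv, rfl⟩ := listEnv_of_getElem? h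
    refine ⟨.exLE v δ, rfl, ⟨hv, hs⟩, (ltBit_count _ _).trans (bit_eq_bit ?_)⟩
    simp only [Nat.lt_succ_iff, Holds]
  | countZero e d b =>
    obtain ⟨δ, rfl, hs, _⟩ := ih _ List.mem_cons_self
    exact ⟨δ, rfl, hs, (Nat.count_zero _).symm⟩
  | countSucc e m d s b =>
    obtain ⟨δ, rfl, hs, rfl⟩ := ih (1 :: m :: d :: s :: e) (by simp)
    obtain ⟨ε, hε, _, rfl⟩ := ih (0 :: δ.code :: b :: m :: e) (by simp)
    obtain rfl := PureDelta.code_injective hε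
    refine ⟨ε, rfl, hs, ?_⟩
    rw [Nat.count_succ, listEnv_cons]
    rfl

theorem truthMeaning_of_closure {c : List ℕ} (h : Closure TruthRule c) : TruthMeaning c := by
  induction h with
  | intro h _ ih =>
    exact h.elim truthMeaning_of_atomRule fun h => truthMeaning_of_compoundRule h ih

theorem closure_of_atomRule {c : List ℕ} (h : AtomRule [] c) : Closure TruthRule c :=
  .intro (Or.inl h) (by simp)

theorem closure_of_compoundRule {ps : List (List ℕ)} {c : List ℕ} (h : CompoundRule ps c)
    (hps : ∀ p ∈ ps, Closure TruthRule p) : Closure TruthRule c :=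
  .intro (Or.inr h) hps

open Classical in
theorem closure_count {δ : PureDelta} {e : List ℕ}
    (h : ∀ a, Closure TruthRule (0 :: δ.code :: bit (δ.Holds (push a (listEnv e))) :: a :: e))
    (m : ℕ) : Closure TruthRule
      (1 :: m :: δ.code :: Nat.count (fun a => δ.Holds (push a (listEnv e))) m :: e) := by
  induction m with
  | zero =>
    rw [Nat.count_zero]
    exact closure_of_compoundRule (.countZero e _ _) (by simpa using h 0)
  | succ m ih =>
    rw [Nat.count_succ]
    exact closure_of_compoundRule (.countSucc e m _ _ _) (by simpa using ⟨ih, h m⟩)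

theorem closure_truth (δ : PureDelta) : ∀ {e : List ℕ}, δ.Scoped e.length →
    Closure TruthRule (0 :: δ.code :: bit (δ.Holds (listEnv e)) :: e) := by
  classical
  induction δ with
  | bot =>
    intro e _
    have h : bit (PureDelta.bot.Holds (listEnv e)) = 0 := bit_false id
    rw [h]
    exact closure_of_atomRule (.bot e)
  | top =>
    intro e _
    have h : bit (PureDelta.top.Holds (listEnv e)) = 1 := bit_true trivial
    rw [h]
    exact closure_of_atomRule (.top e)
  | lt u v =>
    intro e h
    have := AtomRule.lt e u v _ _ (getElem?_eq_listEnv h.1) (getElem?_eq_listEnv h.2)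
    rw [ltBit_eq] at this
    exact closure_of_atomRule this
  | zero u =>
    intro e h
    have := AtomRule.zero e u _ (getElem?_eq_listEnv h)
    rw [eqBit_eq] at this
    exact closure_of_atomRule this
  | succ u v =>
    intro e h
    have := AtomRule.succ e u v _ _ (getElem?_eq_listEnv h.1) (getElem?_eq_listEnv h.2)
    rw [eqBit_eq] at this
    exact closure_of_atomRule this
  | add u v w =>
    intro e h
    have := AtomRule.add e u v w _ _ _ (getElem?_eq_listEnv h.1) (getElem?_eq_listEnv h.2.1)
      (getElem?_eq_listEnv h.2.2)
    rw [eqBit_eq] at this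
    exact closure_of_atomRule this
  | mul u v w =>
    intro e h
    have := AtomRule.mul e u v w _ _ _ (getElem?_eq_listEnv h.1) (getElem?_eq_listEnv h.2.1)
      (getElem?_eq_listEnv h.2.2)
    rw [eqBit_eq] at this
    exact closure_of_atomRule this
  | neg δ ih =>
    intro e h
    simp only [Holds, bit_not]
    exact closure_of_compoundRule (.neg e _ _) (by simpa using ih h)
  | and δ ε ih₁ ih₂ =>
    intro e h
    simp only [Holds, bit_and]
    exact closure_of_compoundRule (.and e _ _ _ _) (by simpa using ⟨ih₁ h.1, ih₂ h.2⟩)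
  | or δ ε ih₁ ih₂ =>
    intro e h
    simp only [Holds, bit_or]
    exact closure_of_compoundRule (.or e _ _ _ _) (by simpa using ⟨ih₁ h.1, ih₂ h.2⟩)
  | imp δ ε ih₁ ih₂ =>
    intro e h
    simp only [Holds, bit_imp]
    exact closure_of_compoundRule (.imp e _ _ _ _) (by simpa using ⟨ih₁ h.1, ih₂ h.2⟩)
  | allLT v δ ih =>
    intro e h
    have hc := fun a => listEnv_cons a e ▸ ih (e := a :: e) h.2
    simp only [Holds, ← eqBit_count]
    exact closure_of_compoundRule (.allLT e v _ _ _ (getElem?_eq_listEnv h.1))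
      (by simpa using closure_count hc (listEnv e v))
  | exLT v δ ih =>
    intro e h
    have hc := fun a => listEnv_cons a e ▸ ih (e := a :: e) h.2
    simp only [Holds, ← ltBit_count]
    exact closure_of_compoundRule (.exLT e v _ _ _ (getElem?_eq_listEnv h.1))
      (by simpa using closure_count hc (listEnv e v))
  | allLE v δ ih =>
    intro e h
    have hc := fun a => listEnv_cons a e ▸ ih (e := a :: e) h.2
    simp only [Holds, ← Nat.lt_succ_iff, ← eqBit_count]
    exact closure_of_compoundRule (.allLE e v _ _ _ (getElem?_eq_listEnv h.1))
      (by simpa using closure_count hc (listEnv e v + 1))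
  | exLE v δ ih =>
    intro e h
    have hc := fun a => listEnv_cons a e ▸ ih (e := a :: e) h.2
    simp only [Holds, ← Nat.lt_succ_iff, ← ltBit_count]
    exact closure_of_compoundRule (.exLE e v _ _ _ (getElem?_eq_listEnv h.1))
      (by simpa using closure_count hc (listEnv e v + 1))

theorem listEnv_nil : listEnv [] = fun _ => 0 := by
  funext i; simp [listEnv]

/-- The Gödel numbers of the pure 1-`Σ⁰₁`-sentences form an RE set. -/
theorem rePred_pureSigma : REPred fun n => ∃ σ : PureSigma, σ.code = n := by
  have h : REPred fun n => ∃ b, Closure TruthRule [0, n, b, 0] :=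
    REPred.exists (rePred_closure_truthRule.preimage (by fun_prop))
  refine h.of_eq fun n => ⟨?_, ?_⟩
  · rintro ⟨b, hb⟩
    obtain ⟨δ, hδ, hs, _⟩ := truthMeaning_of_closure hb
    exact ⟨⟨δ, hs⟩, hδ⟩
  · rintro ⟨σ, rfl⟩
    exact ⟨_, closure_truth σ.matrix (e := [0]) σ.closed⟩

/-- The Gödel numbers of the true pure 1-`Σ⁰₁`-sentences form an RE set. -/
theorem rePred_isTrue : REPred fun n => ∃ σ : PureSigma, σ.IsTrue ∧ σ.code = n := by
  have h : REPred fun n => ∃ a, Closure TruthRule [0, n, 1, a] :=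
    REPred.exists (rePred_closure_truthRule.preimage (by fun_prop))
  refine h.of_eq fun n => ⟨?_, ?_⟩
  · rintro ⟨a, ha⟩
    obtain ⟨δ, hδ, hs, h1⟩ := truthMeaning_of_closure ha
    refine ⟨⟨δ, hs⟩, ⟨a, ?_⟩, hδ⟩
    rw [← listEnv_nil, ← listEnv_cons]
    exact bit_eq_one_iff.1 h1.symm
  · rintro ⟨σ, ⟨a, ha⟩, rfl⟩
    refine ⟨a, ?_⟩
    have := closure_truth σ.matrix (e := [a]) σ.closed
    rwa [listEnv_cons, listEnv_nil, bit_true ha] at this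

end Truth

/-! ### Witness comparison -/

section Main

variable {L : FirstOrder.Language.{u, v}}

variable [Encodable (Σ n, L.Functions n)] [Encodable (Σ n, L.Relations n)]

/-- The Gödel number of `σ ≤ τ` from those of `σ` and `τ`. -/
def wleCode (s t : ℕ) : ℕ := Nat.pair 8 (Nat.pair s (Nat.pair 11 (Nat.pair 0 (Nat.pair 7 t))))

/-- The Gödel number of `σ < τ` from those of `σ` and `τ`. -/
def wltCode (s t : ℕ) : ℕ := Nat.pair 8 (Nat.pair s (Nat.pair 13 (Nat.pair 0 (Nat.pair 7 t))))

@[fun_prop]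
theorem computable_wleCode {α : Type*} [Primcodable α] {f g : α → ℕ} (hf : Computable f)
    (hg : Computable g) : Computable fun a => wleCode (f a) (g a) := by
  unfold wleCode; fun_prop

@[fun_prop]
theorem computable_wltCode {α : Type*} [Primcodable α] {f g : α → ℕ} (hf : Computable f)
    (hg : Computable g) : Computable fun a => wltCode (f a) (g a) := by
  unfold wltCode; fun_prop

theorem PureDelta.holds_congr {δ : PureDelta} : ∀ {n : ℕ} {e e' : ℕ → ℕ}, δ.Scoped n →
    (∀ i < n, e i = e' i) → (δ.Holds e ↔ δ.Holds e') := by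
  have hpush : ∀ {n : ℕ} {e e' : ℕ → ℕ} (a : ℕ), (∀ i < n, e i = e' i) →
      ∀ i < n + 1, push a e i = push a e' i := by
    intro n e e' a h i hi
    cases i with
    | zero => rfl
    | succ i => exact h i (Nat.lt_of_succ_lt_succ hi)
  induction δ with
  | bot | top => exact fun _ _ => Iff.rfl
  | lt u v | succ u v => intro n e e' hs h; simp only [Holds, h u hs.1, h v hs.2]
  | zero u => intro n e e' hs h; simp only [Holds, h u hs]
  | add u v w | mul u v w =>
    intro n e e' hs h; simp only [Holds, h u hs.1, h v hs.2.1, h w hs.2.2]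
  | neg δ ih => intro n e e' hs h; exact not_congr (ih hs h)
  | and δ ε ih₁ ih₂ => intro n e e' hs h; exact and_congr (ih₁ hs.1 h) (ih₂ hs.2 h)
  | or δ ε ih₁ ih₂ => intro n e e' hs h; exact or_congr (ih₁ hs.1 h) (ih₂ hs.2 h)
  | imp δ ε ih₁ ih₂ => intro n e e' hs h; exact imp_congr (ih₁ hs.1 h) (ih₂ hs.2 h)
  | allLT v δ ih | allLE v δ ih =>
    intro n e e' hs h
    simp only [Holds, h v hs.1]
    exact forall₂_congr fun a _ => ih hs.2 (hpush a h)
  | exLT v δ ih | exLE v δ ih =>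
    intro n e e' hs h
    simp only [Holds, h v hs.1]
    exact exists_congr fun a => and_congr_right fun _ => ih hs.2 (hpush a h)

namespace PureSigma

theorem code_wle (σ τ : PureSigma) : (σ.wle τ).code = wleCode σ.code τ.code := rfl

/-- The witnesses of a pure 1-`Σ⁰₁`-sentence. -/
def Witness (σ : PureSigma) (a : ℕ) : Prop := σ.matrix.Holds (push a fun _ => 0)

theorem holds_push_push (σ : PureSigma) (a b : ℕ) :
    σ.matrix.Holds (push a (push b fun _ => 0)) ↔ σ.Witness a :=
  PureDelta.holds_congr σ.closed fun i hi => by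
    obtain rfl := Nat.lt_one_iff.1 hi
    rfl

theorem isTrue_wle {σ τ : PureSigma} :
    (σ.wle τ).IsTrue ↔ ∃ a, σ.Witness a ∧ ∀ b < a, ¬ τ.Witness b := by
  simp only [IsTrue, wle, PureDelta.Holds, holds_push_push]
  rfl

theorem isTrue_wlt {σ τ : PureSigma} :
    (σ.wlt τ).IsTrue ↔ ∃ a, σ.Witness a ∧ ∀ b ≤ a, ¬ τ.Witness b := by
  simp only [IsTrue, wlt, PureDelta.Holds, holds_push_push]
  rfl

theorem isTrue_wle_of_not {σ τ : PureSigma} (hσ : σ.IsTrue) (hτ : ¬ τ.IsTrue) :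
    (σ.wle τ).IsTrue :=
  let ⟨a, ha⟩ := hσ
  isTrue_wle.2 ⟨a, ha, fun b _ hb => hτ ⟨b, hb⟩⟩

theorem isTrue_wlt_of_not {σ τ : PureSigma} (hσ : σ.IsTrue) (hτ : ¬ τ.IsTrue) :
    (σ.wlt τ).IsTrue :=
  let ⟨a, ha⟩ := hσ
  isTrue_wlt.2 ⟨a, ha, fun b _ hb => hτ ⟨b, hb⟩⟩

theorem not_isTrue_wlt_of_wle {σ τ : PureSigma} (h : (σ.wle τ).IsTrue) : ¬ (τ.wlt σ).IsTrue := by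
  rw [isTrue_wlt]
  rintro ⟨b, hb, hb'⟩
  obtain ⟨a, ha, ha'⟩ := isTrue_wle.1 h
  rcases lt_or_ge b a with h | h
  · exact ha' b h hb
  · exact hb' a h ha

end PureSigma

/-! ### Effective inseparability from representativity -/

theorem rePred_eval_dom {α : Type*} [Primcodable α] {c : α → Nat.Partrec.Code} {f : α → ℕ}
    (hc : Computable c) (hf : Computable f) : REPred fun a => ((c a).eval (f a)).Dom :=
  (Partrec.dom_re Nat.Partrec.Code.eval_part).preimage (hc.pair hf)

/-- The recursion theorem for RE sets: an RE condition on `n` may refer to a code `c` of the set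
that it defines. -/
theorem exists_code_of_rePred {A : Nat.Partrec.Code → ℕ → Prop}
    (hA : REPred fun x : Nat.Partrec.Code × ℕ => A x.1 x.2) :
    ∃ c : Nat.Partrec.Code, ∀ n, (c.eval n).Dom ↔ A c n := by
  obtain ⟨f, hf, h⟩ := rePred_iff_exists_partrec.1 hA
  have hf' : Partrec₂ fun (c : Nat.Partrec.Code) (n : ℕ) => (f (c, n)).map fun _ => 0 :=
    Partrec.map hf (Computable.const 0).to₂
  obtain ⟨c, hc⟩ := Nat.Partrec.Code.fixed_point₂ hf'
  exact ⟨c, fun n => by rw [hc]; exact (h (c, n)).symm⟩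

/-- A fixed point gives `Σ⁰₁`-sentences `σ` and `τ` that say, of the sentence `φ = Φ(σ ≤ τ)`, that
`φ ∈ W j` and that `φ ∈ W i`. If one of them held, then `φ` would be a theorem or a refutable
sentence that belongs to the wrong side, so `φ` avoids both sets. -/
theorem SigmaRepresentative.effectivelyInseparable {T : L.Theory} (h : SigmaRepresentative T) :
    EffectivelyInseparable T := by
  obtain ⟨Φ, ⟨f, hf, hfΦ⟩, htrue, hcmp⟩ := h
  obtain ⟨s, hs, hsA⟩ := exists_pureSigma_of_rePred
    (A := fun n => ((Denumerable.ofNat Nat.Partrec.Code n.unpair.1).eval n.unpair.2).Dom)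
    (rePred_eval_dom
      ((Computable.ofNat _).comp (Computable.fst.comp Computable.unpair))
      (Computable.snd.comp Computable.unpair))
  -- `v c k` is the number of `Φ(σ ≤ τ)` for `σ` and `τ` that say that `c` halts at `(0, k)` and at
  -- `(1, k)`
  obtain ⟨v, hvdef⟩ : ∃ v : Nat.Partrec.Code → ℕ → ℕ, ∀ c k, v c k =
    f (wleCode (s (Nat.pair (Encodable.encode c) (Nat.pair 0 k))).code
      (s (Nat.pair (Encodable.encode c) (Nat.pair 1 k))).code) := ⟨_, fun _ _ => rfl⟩
  have hv : Computable fun x : Nat.Partrec.Code × ℕ => v x.1 x.2 := by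
    have : Computable fun c : Nat.Partrec.Code => Encodable.encode c := Computable.encode
    simp only [hvdef]
    exact hf.comp (computable_wleCode
      (hs.comp (g := fun x : Nat.Partrec.Code × ℕ => Nat.pair (Encodable.encode x.1)
        (Nat.pair 0 x.2)) (by fun_prop))
      (hs.comp (g := fun x : Nat.Partrec.Code × ℕ => Nat.pair (Encodable.encode x.1)
        (Nat.pair 1 x.2)) (by fun_prop)))
  have hunpair : Computable Nat.unpair := Computable.unpair
  have hdec : Computable (Denumerable.ofNat (Nat.Partrec.Code × Nat.Partrec.Code)) :=
    Computable.ofNat _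
  obtain ⟨c, hc⟩ := exists_code_of_rePred
    (A := fun c n =>
      (n.unpair.1 = 0 ∧ ((Denumerable.ofNat (Nat.Partrec.Code × Nat.Partrec.Code)
        n.unpair.2).2.eval (v c n.unpair.2)).Dom) ∨
      (n.unpair.1 = 1 ∧ ((Denumerable.ofNat (Nat.Partrec.Code × Nat.Partrec.Code)
        n.unpair.2).1.eval (v c n.unpair.2)).Dom))
    (by
      have hvu : Computable fun x : Nat.Partrec.Code × ℕ => v x.1 x.2.unpair.2 :=
        hv.comp (f := fun x : Nat.Partrec.Code × ℕ => v x.1 x.2)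
          (g := fun x : Nat.Partrec.Code × ℕ => (x.1, x.2.unpair.2)) (by fun_prop)
      exact ((rePred_eq (by fun_prop) (by fun_prop)).and
        (rePred_eval_dom (by fun_prop) hvu)).or
        ((rePred_eq (by fun_prop) (by fun_prop)).and (rePred_eval_dom (by fun_prop) hvu)))
  refine ⟨fun x => Part.some (v c (Encodable.encode x)), ?_, fun i j hi hj hij => ?_⟩
  · have : Computable fun x : Nat.Partrec.Code × Nat.Partrec.Code => v c (Encodable.encode x) :=
      hv.comp ((Computable.const c).pair Computable.encode)
    exact this
  · obtain ⟨σ, hσ⟩ : ∃ σ, σ = s (Nat.pair (Encodable.encode c)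
        (Nat.pair 0 (Encodable.encode (i, j)))) := ⟨_, rfl⟩
    obtain ⟨τ, hτ⟩ : ∃ τ, τ = s (Nat.pair (Encodable.encode c)
        (Nat.pair 1 (Encodable.encode (i, j)))) := ⟨_, rfl⟩
    have hcode : v c (Encodable.encode (i, j)) = sentenceCode (Φ (σ.wle τ)) := by
      rw [hvdef, ← hfΦ, PureSigma.code_wle, hσ, hτ]
    have hσt : σ.IsTrue ↔ Φ (σ.wle τ) ∈ W j := by
      change _ ↔ (j.eval (sentenceCode (Φ (σ.wle τ)))).Dom
      rw [← hcode, hσ, hsA, Nat.unpair_pair, Denumerable.ofNat_encode, hc, Nat.unpair_pair]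
      simp only [Denumerable.ofNat_encode, true_and, zero_ne_one, false_and, or_false]
    have hτt : τ.IsTrue ↔ Φ (σ.wle τ) ∈ W i := by
      change _ ↔ (i.eval (sentenceCode (Φ (σ.wle τ)))).Dom
      rw [← hcode, hτ, hsA, Nat.unpair_pair, Denumerable.ofNat_encode, hc, Nat.unpair_pair]
      simp only [Denumerable.ofNat_encode, true_and, one_ne_zero, false_and, false_or]
    have hdisj : ∀ φ, φ ∈ W i → φ ∉ W j := fun φ h₁ h₂ => Set.disjoint_left.1 hij h₁ h₂
    refine ⟨Φ (σ.wle τ), hcode ▸ Part.mem_some _, fun h₁ => ?_, fun h₂ => ?_⟩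
    · have hnot : ¬ σ.IsTrue := fun h => hdisj _ h₁ (hσt.1 h)
      exact hdisj _ h₁ (hj ((hcmp τ σ).2 (PureSigma.isTrue_wlt_of_not (hτt.2 h₁) hnot)))
    · have hnot : ¬ τ.IsTrue := fun h => hdisj _ (hτt.1 h) h₂
      exact hdisj _ (hi (htrue _ (PureSigma.isTrue_wle_of_not (hσt.2 h₂) hnot))) h₂

/-! ### Representativity from effective inseparability -/

/-- An effectively inseparable theory separates every disjoint pair of RE sets `P`, `N` of numbers:
a recursive function maps `P` into the provable and `N` into the refutable sentences. For the proof,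
a fixed point lets the value `φ` at `x` enter the set `W i` of theorems if `x ∈ N` and the set `W j`
of refutable sentences if `x ∈ P`. As `φ` avoids `W i` and `W j` whenever they are disjoint, it must
be refutable in the first case and provable in the second. In every case `φ` exists, so the function
is total. -/
theorem EffectivelyInseparable.exists_reduction [Finite (Σ n, L.Functions n)]
    [Finite (Σ n, L.Relations n)] {T : L.Theory} (h : EffectivelyInseparable T) (hRE : IsRE T)
    (hT : Consistent T) {P N : ℕ → Prop} (hP : REPred P) (hN : REPred N)
    (hPN : ∀ x, P x → ¬ N x) :
    ∃ f : ℕ → ℕ, Computable f ∧ ∀ x, ∃ φ : L.Sentence, f x = sentenceCode φ ∧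
      (P x → Proves T φ) ∧ (N x → Proves T φ.not) := by
  obtain ⟨Ψ, hΨ, hsep⟩ := h
  obtain ⟨D, hD, hDT⟩ := exists_rePred_iff_proves hRE
  have hunpair : Computable Nat.unpair := Computable.unpair
  have hcurry : Computable fun x : Nat.Partrec.Code × ℕ => x.1.curry x.2 :=
    Nat.Partrec.Code.primrec₂_curry.to_comp
  let I : Nat.Partrec.Code → ℕ → Nat.Partrec.Code × Nat.Partrec.Code := fun c x =>
    (c.curry (Nat.pair 0 x), c.curry (Nat.pair 1 x))
  have hI : Computable fun x : Nat.Partrec.Code × ℕ => I x.1 x.2 :=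
    (hcurry.comp (g := fun x : Nat.Partrec.Code × ℕ => (x.1, Nat.pair 0 x.2)) (by fun_prop)).pair
      (hcurry.comp (g := fun x : Nat.Partrec.Code × ℕ => (x.1, Nat.pair 1 x.2)) (by fun_prop))
  -- the argument `n` stands for `((side, x), m)`
  obtain ⟨c, hc⟩ := exists_code_of_rePred
    (A := fun c n =>
      (n.unpair.1.unpair.1 = 0 ∧ (D n.unpair.2 ∨
        N n.unpair.1.unpair.2 ∧ n.unpair.2 ∈ Ψ (I c n.unpair.1.unpair.2))) ∨
      (n.unpair.1.unpair.1 = 1 ∧ (D (Nat.pair 3 (Nat.pair n.unpair.2 (Nat.pair 0 0))) ∨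
        P n.unpair.1.unpair.2 ∧ n.unpair.2 ∈ Ψ (I c n.unpair.1.unpair.2))))
    (by
      have hmem : REPred fun x : Nat.Partrec.Code × ℕ =>
          x.2.unpair.2 ∈ Ψ (I x.1 x.2.unpair.1.unpair.2) :=
        hΨ.rePred_mem.preimage (f := fun x : Nat.Partrec.Code × ℕ =>
          (I x.1 x.2.unpair.1.unpair.2, x.2.unpair.2))
          ((hI.comp (g := fun x : Nat.Partrec.Code × ℕ => (x.1, x.2.unpair.1.unpair.2))
            (by fun_prop)).pair (by fun_prop))
      exact ((rePred_eq (by fun_prop) (by fun_prop)).and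
        ((hD.preimage (by fun_prop)).or ((hN.preimage (by fun_prop)).and hmem))).or
        ((rePred_eq (by fun_prop) (by fun_prop)).and
        ((hD.preimage (by fun_prop)).or ((hP.preimage (by fun_prop)).and hmem))))
  have hWi : ∀ x (φ : L.Sentence), φ ∈ W (I c x).1 ↔
      Proves T φ ∨ N x ∧ sentenceCode φ ∈ Ψ (I c x) := by
    intro x φ
    change ((c.curry (Nat.pair 0 x)).eval _).Dom ↔ _
    rw [Nat.Partrec.Code.eval_curry, hc]
    simp [hDT]
  have hWj : ∀ x (φ : L.Sentence), φ ∈ W (I c x).2 ↔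
      Proves T φ.not ∨ P x ∧ sentenceCode φ ∈ Ψ (I c x) := by
    intro x φ
    change ((c.curry (Nat.pair 1 x)).eval _).Dom ↔ _
    rw [Nat.Partrec.Code.eval_curry, hc]
    simp [← sentenceCode_not, hDT]
  have key : ∀ x, ∃ φ : L.Sentence, sentenceCode φ ∈ Ψ (I c x) ∧
      (P x → Proves T φ) ∧ (N x → Proves T φ.not) := by
    intro x
    have hi : provable T ⊆ W (I c x).1 := fun φ hφ => (hWi x φ).2 (Or.inl hφ)
    have hj : refutable T ⊆ W (I c x).2 := fun φ hφ => (hWj x φ).2 (Or.inl hφ)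
    by_cases hdisj : Disjoint (W (I c x).1 : Set L.Sentence) (W (I c x).2)
    · obtain ⟨φ, hφ, hφi, hφj⟩ := hsep _ _ hi hj hdisj
      rw [hWi] at hφi
      rw [hWj] at hφj
      exact ⟨φ, hφ, fun h => absurd (Or.inr ⟨h, hφ⟩) hφj, fun h => absurd (Or.inr ⟨h, hφ⟩) hφi⟩
    · obtain ⟨φ, hφi, hφj⟩ := Set.not_disjoint_iff.1 hdisj
      rcases (hWi x φ).1 hφi with hpr | ⟨hN, hφ⟩ <;> rcases (hWj x φ).1 hφj with hre | ⟨hP, hφ'⟩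
      · exact absurd hre (hT.not_proves_not hpr)
      · exact ⟨φ, hφ', fun _ => hpr, fun hN => absurd hN (hPN x hP)⟩
      · exact ⟨φ, hφ, fun hP => absurd hN (hPN x hP), fun _ => hre⟩
      · exact absurd hN (hPN x hP)
  choose φ hφ hφP hφN using key
  refine ⟨fun x => sentenceCode (φ x), ?_, fun x => ⟨φ x, rfl, hφP x, hφN x⟩⟩
  have hΨI : Partrec fun x => Ψ (I c x) :=
    hΨ.comp (hI.comp (g := fun x : ℕ => (c, x)) (by fun_prop))
  exact hΨI.of_eq_tot hφ

/-- The Gödel numbers of the sentences that a witness comparison makes refutable. -/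
def IsComparisonRefuted (n : ℕ) : Prop :=
  ∃ σ τ : PureSigma, ((σ.wle τ).IsTrue ∧ (τ.wlt σ).code = n) ∨
    ((σ.wlt τ).IsTrue ∧ (τ.wle σ).code = n)

theorem rePred_isComparisonRefuted : REPred IsComparisonRefuted := by
  have h : REPred fun n => ∃ s t : ℕ, (∃ σ : PureSigma, σ.code = s) ∧
      (∃ τ : PureSigma, τ.code = t) ∧
      (((∃ ρ : PureSigma, ρ.IsTrue ∧ ρ.code = wleCode s t) ∧ wltCode t s = n) ∨
        ((∃ ρ : PureSigma, ρ.IsTrue ∧ ρ.code = wltCode s t) ∧ wleCode t s = n)) := by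
    refine REPred.exists (REPred.exists (REPred.and (rePred_pureSigma.preimage ?_)
      (REPred.and (rePred_pureSigma.preimage ?_)
        (REPred.or (REPred.and (rePred_isTrue.preimage ?_) (rePred_eq ?_ ?_))
          (REPred.and (rePred_isTrue.preimage ?_) (rePred_eq ?_ ?_))))))
    all_goals fun_prop
  refine h.of_eq fun n => ⟨?_, ?_⟩
  · rintro ⟨_, _, ⟨σ, rfl⟩, ⟨τ, rfl⟩, ⟨⟨ρ, hρ, hcode⟩, rfl⟩ | ⟨⟨ρ, hρ, hcode⟩, rfl⟩⟩
    · obtain rfl : ρ = σ.wle τ := PureSigma.code_injective hcode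
      exact ⟨σ, τ, Or.inl ⟨hρ, rfl⟩⟩
    · obtain rfl : ρ = σ.wlt τ := PureSigma.code_injective hcode
      exact ⟨σ, τ, Or.inr ⟨hρ, rfl⟩⟩
  · rintro ⟨σ, τ, ⟨h, rfl⟩ | ⟨h, rfl⟩⟩
    · exact ⟨_, _, ⟨σ, rfl⟩, ⟨τ, rfl⟩, Or.inl ⟨⟨_, h, rfl⟩, rfl⟩⟩
    · exact ⟨_, _, ⟨σ, rfl⟩, ⟨τ, rfl⟩, Or.inr ⟨⟨_, h, rfl⟩, rfl⟩⟩

/-- True sentences and sentences refuted by a witness comparison form a disjoint pair of RE sets,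
to which `EffectivelyInseparable.exists_reduction` applies. -/
theorem EffectivelyInseparable.sigmaRepresentative [Finite (Σ n, L.Functions n)]
    [Finite (Σ n, L.Relations n)] {T : L.Theory} (h : EffectivelyInseparable T) (hRE : IsRE T)
    (hT : Consistent T) : SigmaRepresentative T := by
  have hdisj : ∀ n, (∃ σ : PureSigma, σ.IsTrue ∧ σ.code = n) → ¬ IsComparisonRefuted n := by
    rintro _ ⟨ρ, hρ, rfl⟩ ⟨σ, τ, ⟨h, hcode⟩ | ⟨h, hcode⟩⟩
    · rw [← PureSigma.code_injective hcode] at hρ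
      exact PureSigma.not_isTrue_wlt_of_wle h hρ
    · rw [← PureSigma.code_injective hcode] at hρ
      exact PureSigma.not_isTrue_wlt_of_wle hρ h
  obtain ⟨f, hf, hφ⟩ := h.exists_reduction hRE hT rePred_isTrue rePred_isComparisonRefuted hdisj
  choose φ hfφ hφP hφN using hφ
  refine ⟨fun σ => φ σ.code, ⟨f, hf, fun σ => hfφ _⟩, fun σ hσ => hφP _ ⟨σ, hσ, rfl⟩,
    fun σ τ => ⟨fun h => ?_, fun h => ?_⟩⟩
  · exact hφN _ ⟨σ, τ, Or.inl ⟨h, rfl⟩⟩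
  · exact hφN _ ⟨σ, τ, Or.inr ⟨h, rfl⟩⟩

end Main

end SigmaRep

theorem mainTheorem7 (L : FirstOrder.Language)
    [Finite (Σ n, L.Functions n)] [Finite (Σ n, L.Relations n)]
    [Encodable (Σ n, L.Functions n)] [Encodable (Σ n, L.Relations n)]
    (U : L.Theory) (hRE : SigmaRep.IsRE U) (hcons : SigmaRep.Consistent U) :
    SigmaRep.SigmaRepresentative U ↔ SigmaRep.EffectivelyInseparable U :=
  ⟨fun h => h.effectivelyInseparable, fun h => h.sigmaRepresentative hRE hcons⟩
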